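/- For complex $\nu$ and $n\ge 0$ let $a_n(\nu)=\dfrac{(4\nu^2-1^2)(4\nu^2-3^2)\cdots(4\nu^2-(2n-1)^2)}{8^n\,n!}$ (so $a_0(\nu)=1$), let $J_\nu$ and $K_\nu$ be the Bessel function of the first kind and the modified Bessel function of the second kind (principal branches), and let $\omega=z-\frac{\pi}{2}\nu-\frac{\pi}{4}$. Define the remainders $R_N^{(K)}(z,\nu)$, $|\arg z|<\pi$, by $$K_\nu(z)=\Big(\frac{\pi}{2z}\Big)^{1/2}e^{-z}\Big(\sum_{n=0}^{N-1}\frac{a_n(\nu)}{z^n}+R_N^{(K)}(z,\nu)\Big),$$ where $z^{1/2}$ is the principal square root, and, for $|\arg z|<\frac{\pi}{2}$ and non-negative integers $L$, $M$, define the remainders $R_{2L}^{(J)}$ and $R_{2M+1}^{(J)}$ by $$2R_{2L}^{(J)}(z,\nu)=R_{2L}^{(K)}(ze^{\frac{\pi}{2}i},\nu)+R_{2L}^{(K)}(ze^{-\frac{\pi}{2}i},\nu),\qquad 2iR_{2M+1}^{(J)}(z,\nu)=R_{2M+1}^{(K)}(ze^{\frac{\pi}{2}i},\nu)-R_{2M+1}^{(K)}(ze^{-\frac{\pi}{2}i},\nu).$$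 **Theorem.** Let $N$ be a non-negative integer, let $\nu$ be a complex number with $|\Re\nu|<N+\frac12$, and let $z\ne0$ satisfy $|\arg z|<\frac{\pi}{2}$. Then the $R_n^{(J)}(z,\nu)$ are the remainders in the large-argument expansion of $J_\nu$: for all non-negative integers $L$ and $M$, $$J_\nu(z)=\Big(\frac{2}{\pi z}\Big)^{1/2}\Big(\cos\omega\Big(\sum_{n=0}^{L-1}(-1)^n\frac{a_{2n}(\nu)}{z^{2n}}+R_{2L}^{(J)}(z,\nu)\Big)-\sin\omega\Big(\sum_{m=0}^{M-1}(-1)^m\frac{a_{2m+1}(\nu)}{z^{2m+1}}-R_{2M+1}^{(J)}(z,\nu)\Big)\Big);$$ moreover $$R_N^{(J)}(z,\nu)=(-1)^{\lfloor N/2\rfloor}\Big(\frac{2}{\pi}\Big)^{1/2}\frac{\cos(\pi\nu)}{\pi}\frac{1}{z^N}\int_0^{+\infty}\frac{t^{N-\frac12}e^{-t}}{1+(t/z)^2}K_\nu(t)\,dt,$$ where the integral converges absolutely. -/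

import Mathlib

/-- The Bessel function `J_ν(z) = ∑ (-1)^k (z/2)^(ν+2k) / (k! Γ(ν+k+1))`, principal branch of
`(z/2)^ν`; the terms at poles of `Γ` vanish (there `Complex.Gamma` is `0`, with inverse `0`). -/
noncomputable def besselJ (ν z : ℂ) : ℂ :=
  (z / 2) ^ ν *
    ∑' k : ℕ, (-1) ^ k * (z / 2) ^ (2 * k) / ((k.factorial : ℂ) * Complex.Gamma (ν + k + 1))

/-- The modified Bessel function of the first kind
`I_ν(z) = ∑ (z/2)^(ν+2k) / (k! Γ(ν+k+1))`, principal branch. -/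
noncomputable def besselI (ν z : ℂ) : ℂ :=
  (z / 2) ^ ν *
    ∑' k : ℕ, (z / 2) ^ (2 * k) / ((k.factorial : ℂ) * Complex.Gamma (ν + k + 1))

/-- The modified Bessel function of the second kind (Macdonald function), principal branch:
`K_ν(z) = (π/2) (I_{-ν}(z) - I_ν(z)) / sin(πν)`, and the limiting value of this expression
in the order when `ν` is an integer. -/
noncomputable def besselK (ν z : ℂ) : ℂ :=
  open Classical in
  if ∃ n : ℤ, ν = n then
    Filter.limUnder (nhdsWithin ν {ν}ᶜ) fun μ : ℂ =>
      (Real.pi : ℂ) / 2 * (besselI (-μ) z - besselI μ z) / Complex.sin (Real.pi * μ)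
  else
    (Real.pi : ℂ) / 2 * (besselI (-ν) z - besselI ν z) / Complex.sin (Real.pi * ν)

/-- The coefficients
`a_n(ν) = (4ν² - 1²)(4ν² - 3²) ⋯ (4ν² - (2n-1)²) / (8^n Γ(n+1))`, `a_0(ν) = 1`. -/
noncomputable def hankelCoeff (n : ℕ) (ν : ℂ) : ℂ :=
  (∏ k ∈ Finset.range n, (4 * ν ^ 2 - (2 * (k : ℂ) + 1) ^ 2)) / (8 ^ n * (n.factorial : ℂ))

/-- The remainder `R_N^{(K)}(z,ν)`, i.e. the number with
`K_ν(z) = (π/(2z))^{1/2} e^{-z} (∑_{n<N} a_n(ν)/z^n + R_N^{(K)}(z,ν))`,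
where `z^{1/2}` is the principal square root. -/
noncomputable def remainderK (N : ℕ) (z ν : ℂ) : ℂ :=
  besselK ν z / (((Real.pi : ℂ) / 2) ^ (1 / 2 : ℂ) / z ^ (1 / 2 : ℂ) * Complex.exp (-z)) -
    ∑ n ∈ Finset.range N, hankelCoeff n ν / z ^ n

/-- The remainder `R_N^{(J)}(z,ν)`: for even `N` it is
`(R_N^{(K)}(z e^{πi/2},ν) + R_N^{(K)}(z e^{-πi/2},ν)) / 2`, and for odd `N` it is
`(R_N^{(K)}(z e^{πi/2},ν) - R_N^{(K)}(z e^{-πi/2},ν)) / (2i)`.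
For `|arg z| < π/2` both points have argument in `(-π, π)`. -/
noncomputable def remainderJ (N : ℕ) (z ν : ℂ) : ℂ :=
  if Even N then
    (remainderK N (z * Complex.I) ν + remainderK N (z * (-Complex.I)) ν) / 2
  else
    (remainderK N (z * Complex.I) ν - remainderK N (z * (-Complex.I)) ν) / (2 * Complex.I)

/-- `ω = z - πν/2 - π/4`. -/
noncomputable def besselPhase (z ν : ℂ) : ℂ :=
  z - (Real.pi : ℂ) / 2 * ν - (Real.pi : ℂ) / 4

/-!
# The remainder in the large-argument expansion of `J_ν`

On the positive axis `K_ν(x) = ½ ∫ e^{νu - x cosh u} du` over the real line (`besselK_ofReal`). To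
get this from the power series, the integral is paired with the series of `I_ν` and `I_{-ν}` by
Wronskians, which are constant in `x`, invariant under `ν ↦ ν + 1`, and computed as `x ↓ 0`
(`gammaKernel_wronskian`, `gammaKernel_mul_sin`).

By Fubini's theorem, an integral of `t^{N-1/2} e^{-t} k(t) K_ν(t)` is a two-sided Laplace transform
in the order `ν`, and so is analytic in `ν` for `|Re ν| < N + 1/2`
(`integral_besselWeight_mul_macdonaldIntegral`, `ExpDecay.analyticOnNhd`). For `k = 1` a beta
integral shows that the moments are the coefficients `a_n(ν)`, up to a common factor
(`remainderConst_mul_moment`). For `k(t) = 1 / (1 + t/x)`, `N = 0`, the substitution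
`t (1 + cosh u) = x (cosh v - 1)` produces the convolution of `e^{-x cosh v}` with a hyperbolic
secant, whose transform is the product `K_ν(x) · π / cos πν` up to elementary factors
(`bilateralLaplace_weightKernel_zero`). Expanding `1 / (1 + t/x)` in a finite geometric series gives
the expansion of `K_ν(x)` with an integral remainder for `|Re ν| < 1/2`. It extends to the strip
`|Re ν| < N + 1/2` by analyticity in `ν` (`macdonaldIntegral_expansion`), then to complex `z` off
the negative axis by analyticity in `z`, and to integer orders by continuity in `ν` (`besselK_eq`).

The statement on `J_ν` follows from `πi J_ν(z) = e^{-πiν/2} K_ν(-iz) - e^{πiν/2} K_ν(iz)`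
(`besselJ_eq_besselK`), as the kernels `1 / (1 + t/(± iz))` add up to `2 / (1 + (t/z)²)`.
-/

open MeasureTheory Filter Topology Set

/-! ### The power series of the Bessel functions -/

/-- On bounded sets of orders, `1/Γ(ν+k+1)` is bounded uniformly in `k`: once `k ≥ |ν|`, each step
of the recurrence divides by a number of modulus at least `1`. -/
theorem exists_norm_inv_Gamma_add_nat_le (R : ℝ) :
    ∃ C : ℝ, 0 ≤ C ∧ ∀ ν : ℂ, ‖ν‖ ≤ R → ∀ k : ℕ, ‖(Complex.Gamma (ν + k + 1))⁻¹‖ ≤ C := by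
  have hB : ∀ k : ℕ, ∃ B : ℝ, ∀ ν ∈ Metric.closedBall (0 : ℂ) R,
      ‖(Complex.Gamma (ν + k + 1))⁻¹‖ ≤ B := fun k =>
    (isCompact_closedBall (0 : ℂ) R).exists_bound_of_continuousOn
      (Complex.differentiable_one_div_Gamma.continuous.comp
        (by fun_prop : Continuous fun ν : ℂ => ν + k + 1)).continuousOn
  choose B hB using hB
  obtain ⟨m, hm⟩ := exists_nat_ge R
  have hle : ∀ k ∈ Finset.range (m + 1), |B k| ≤ ∑ j ∈ Finset.range (m + 1), |B j| :=
    fun k hk => Finset.single_le_sum (f := fun j => |B j|) (fun _ _ => abs_nonneg _) hk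
  refine ⟨∑ j ∈ Finset.range (m + 1), |B j|, Finset.sum_nonneg fun _ _ => abs_nonneg _,
    fun ν hν k => ?_⟩
  have hsmall : ∀ k ≤ m, ‖(Complex.Gamma (ν + k + 1))⁻¹‖ ≤ ∑ j ∈ Finset.range (m + 1), |B j| :=
    fun k hk => (hB k ν (by simpa using hν)).trans ((le_abs_self _).trans
      (hle k (by simpa [Nat.lt_succ_iff] using hk)))
  rcases le_total k m with hk | hk
  · exact hsmall k hk
  induction k, hk using Nat.le_induction with
  | base => exact hsmall m le_rfl
  | succ k hk ih =>
    refine le_trans ?_ ih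
    have h1 := Complex.one_div_Gamma_eq_self_mul_one_div_Gamma_add_one (ν + k + 1)
    have h2 : 1 ≤ ‖ν + k + 1‖ := by
      have : ‖((k + 1 : ℕ) : ℂ)‖ ≤ ‖ν‖ + ‖ν + k + 1‖ := by
        have := norm_sub_le (ν + k + 1) ν
        rwa [show ν + k + 1 - ν = ((k + 1 : ℕ) : ℂ) by push_cast; ring, add_comm ‖ν + k + 1‖] at this
      rw [Complex.norm_natCast] at this
      have hk' : (m : ℝ) ≤ k := by exact_mod_cast hk
      push_cast at this
      linarith
    rw [h1, norm_mul]
    push_cast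
    rw [← add_assoc]
    exact le_mul_of_one_le_left (norm_nonneg _) h2

/-- The entire function `w ↦ ∑ wᵏ / (k! Γ(ν+k+1))`, so that
`I_ν(z) = (z/2)^ν besselSeries ν (z²/4)` and `J_ν(z) = (z/2)^ν besselSeries ν (-z²/4)`. -/
noncomputable def besselSeries (ν w : ℂ) : ℂ :=
  ∑' k : ℕ, w ^ k / ((k.factorial : ℂ) * Complex.Gamma (ν + k + 1))

theorem besselI_eq (ν z : ℂ) : besselI ν z = (z / 2) ^ ν * besselSeries ν (z ^ 2 / 4) := by
  unfold besselI besselSeries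
  congr 2; ext k
  rw [pow_mul]; congr 2; ring

theorem besselJ_eq (ν z : ℂ) : besselJ ν z = (z / 2) ^ ν * besselSeries ν (-(z ^ 2 / 4)) := by
  unfold besselJ besselSeries
  congr 2; ext k
  rw [pow_mul, ← mul_pow]; congr 2; ring

theorem norm_besselSeries_term_le {ν w : ℂ} {r C : ℝ} (hw : ‖w‖ ≤ r) (k : ℕ)
    (hC : ‖(Complex.Gamma (ν + k + 1))⁻¹‖ ≤ C) :
    ‖w ^ k / ((k.factorial : ℂ) * Complex.Gamma (ν + k + 1))‖ ≤ r ^ k / k.factorial * C := by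
  rw [div_mul_eq_div_div, div_eq_mul_inv _ (Complex.Gamma _), norm_mul, norm_div, norm_pow,
    Complex.norm_natCast]
  have hr := (norm_nonneg w).trans hw
  gcongr

theorem summable_besselSeries (ν w : ℂ) :
    Summable fun k : ℕ => w ^ k / ((k.factorial : ℂ) * Complex.Gamma (ν + k + 1)) := by
  obtain ⟨C, -, hC⟩ := exists_norm_inv_Gamma_add_nat_le ‖ν‖
  exact .of_norm_bounded ((Real.summable_pow_div_factorial ‖w‖).mul_right C)
    fun k => norm_besselSeries_term_le le_rfl k (hC ν le_rfl k)

theorem besselSeries_zero_right (ν : ℂ) : besselSeries ν 0 = (Complex.Gamma (ν + 1))⁻¹ := by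
  unfold besselSeries
  rw [tsum_eq_single 0 fun k hk => by simp [hk]]
  simp

theorem continuous_besselSeries_order (w : ℂ) : Continuous fun ν => besselSeries ν w := by
  rw [continuous_iff_continuousAt]
  intro ν₀
  obtain ⟨C, -, hC⟩ := exists_norm_inv_Gamma_add_nat_le (‖ν₀‖ + 1)
  have hcont : ContinuousOn (fun ν => besselSeries ν w) (Metric.closedBall 0 (‖ν₀‖ + 1)) := by
    refine continuousOn_tsum (fun k => Continuous.continuousOn ?_)
      ((Real.summable_pow_div_factorial ‖w‖).mul_right C)
      fun k ν hν => norm_besselSeries_term_le le_rfl k (hC ν (by simpa using hν) k)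
    have h := Complex.differentiable_one_div_Gamma.continuous.comp
      (by fun_prop : Continuous fun ν : ℂ => ν + k + 1)
    convert (continuous_const (y := w ^ k / (k.factorial : ℂ))).mul h using 2 with ν
    simp only [Function.comp_apply, div_eq_mul_inv, mul_inv, Pi.mul_apply, mul_assoc]
  exact hcont.continuousAt (Metric.closedBall_mem_nhds_of_mem (by simp))

/-- The termwise derivative of the series of order `ν` is the series of order `ν + 1`. -/
theorem hasSum_besselSeries_deriv (ν w : ℂ) :
    HasSum (fun k : ℕ => k * w ^ (k - 1) / ((k.factorial : ℂ) * Complex.Gamma (ν + k + 1)))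
      (besselSeries (ν + 1) w) := by
  rw [← hasSum_nat_add_iff' 1]
  simp only [Finset.range_one, Finset.sum_singleton, Nat.cast_zero, zero_mul, zero_div, sub_zero,
    Nat.add_sub_cancel]
  refine (summable_besselSeries (ν + 1) w).hasSum.congr_fun fun k => ?_
  have hk : ((k : ℂ) + 1) ≠ 0 := by exact_mod_cast k.succ_ne_zero
  rw [Nat.factorial_succ]
  push_cast
  rw [mul_assoc ((k : ℂ) + 1), mul_div_mul_left _ _ hk]
  ring_nf

theorem hasDerivAt_besselSeries (ν w : ℂ) :
    HasDerivAt (besselSeries ν) (besselSeries (ν + 1) w) w := by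
  obtain ⟨C, -, hC⟩ := exists_norm_inv_Gamma_add_nat_le ‖ν‖
  have hu := (Real.summable_pow_div_factorial (‖w‖ + 1)).mul_right C
  have hd : ∀ k : ℕ, Differentiable ℂ
      fun w : ℂ => w ^ k / ((k.factorial : ℂ) * Complex.Gamma (ν + k + 1)) := fun k => by fun_prop
  have hb : ∀ (k : ℕ) (v : ℂ), v ∈ Metric.ball (0 : ℂ) (‖w‖ + 1) →
      ‖v ^ k / ((k.factorial : ℂ) * Complex.Gamma (ν + k + 1))‖
        ≤ (‖w‖ + 1) ^ k / k.factorial * C := fun k v hv =>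
    norm_besselSeries_term_le (by simpa using (mem_ball_zero_iff.mp hv).le) k (hC ν le_rfl k)
  have hw : w ∈ Metric.ball (0 : ℂ) (‖w‖ + 1) := by simp
  have h1 := Complex.differentiableOn_tsum_of_summable_norm hu
    (fun k => (hd k).differentiableOn) Metric.isOpen_ball hb
  have h2 := Complex.hasSum_deriv_of_summable_norm hu
    (fun k => (hd k).differentiableOn) Metric.isOpen_ball hb hw
  have h3 := (h1.differentiableAt (Metric.isOpen_ball.mem_nhds hw)).hasDerivAt
  refine h3.congr_deriv (h2.unique ((hasSum_besselSeries_deriv ν w).congr_fun fun k => ?_))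
  simp

theorem besselSeries_sub_one (ν w : ℂ) :
    besselSeries (ν - 1) w = ν * besselSeries ν w + w * besselSeries (ν + 1) w := by
  have h := ((summable_besselSeries ν w).hasSum.mul_left ν).add
    ((hasSum_besselSeries_deriv ν w).mul_left w)
  refine (summable_besselSeries (ν - 1) w).hasSum.unique ?_
  refine h.congr_fun fun k => ?_
  have h1 := Complex.one_div_Gamma_eq_self_mul_one_div_Gamma_add_one (ν + k)
  have h2 : w * (k * w ^ (k - 1)) = k * w ^ k := by
    rcases k with _ | k
    · simp
    · simp only [Nat.add_sub_cancel]; ring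
  rw [show ν - 1 + k + 1 = ν + k by ring, ← mul_div_assoc w, h2]
  rw [div_mul_eq_div_div, div_eq_mul_inv _ (Complex.Gamma _), h1]
  field_simp

/-- The Wronskian of `I_ν` and `I_{-ν}`, in terms of the entire parts. -/
theorem besselSeries_wronskian (ν w : ℂ) :
    besselSeries (-ν) w * besselSeries (ν - 1) w
      - w * besselSeries (1 - ν) w * besselSeries ν w = Complex.sin (Real.pi * ν) / Real.pi := by
  set f : ℂ → ℂ := fun w => besselSeries (-ν) w * besselSeries (ν - 1) w
      - w * besselSeries (1 - ν) w * besselSeries ν w with hf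
  have hderiv : ∀ w, HasDerivAt f 0 w := by
    intro w
    have hE := fun ν => hasDerivAt_besselSeries ν w
    have := ((hE (-ν)).mul (hE (ν - 1))).sub (((hasDerivAt_id w).mul (hE (1 - ν))).mul (hE ν))
    refine (this.congr_deriv ?_)
    have e1 := besselSeries_sub_one ν w
    have e2 := besselSeries_sub_one (1 - ν) w
    rw [show (1 - ν - 1 : ℂ) = -ν by ring] at e2
    rw [show (-ν + 1 : ℂ) = 1 - ν by ring, show (ν - 1 + 1 : ℂ) = ν by ring, e1, e2]
    simp only [id, Pi.mul_apply]
    ring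
  have h0 : f w = f 0 := is_const_of_deriv_eq_zero (fun w => (hderiv w).differentiableAt)
    (fun w => (hderiv w).deriv) w 0
  have hG := Complex.Gamma_mul_Gamma_one_sub ν
  change f w = _
  rw [h0, hf]
  simp only [besselSeries_zero_right, zero_mul, sub_zero]
  rw [show (-ν + 1 : ℂ) = 1 - ν by ring, show (ν - 1 + 1 : ℂ) = ν by ring, ← mul_inv, mul_comm,
    hG, inv_div]

/-! ### Two-sided Laplace transforms -/

theorem integrable_exp_neg_mul_abs {c : ℝ} (hc : 0 < c) :
    Integrable fun u : ℝ => Real.exp (-(c * |u|)) := by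
  rw [← integrableOn_univ, ← Set.Iic_union_Ioi (a := (0 : ℝ))]
  refine IntegrableOn.union ?_ ?_
  · refine (integrableOn_exp_mul_Iic hc 0).congr_fun (fun u hu => ?_) measurableSet_Iic
    simp only [abs_of_nonpos (mem_Iic.mp hu), mul_neg, neg_neg]
  · refine (integrableOn_exp_mul_Ioi (neg_lt_zero.mpr hc) 0).congr_fun (fun u hu => ?_)
      measurableSet_Ioi
    simp only [abs_of_pos (mem_Ioi.mp hu), neg_mul]

/-- The two-sided Laplace transform `∫ e^{νu} φ(u) du` over the real line. -/
noncomputable def bilateralLaplace (φ : ℝ → ℝ) (ν : ℂ) : ℂ :=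
  ∫ u : ℝ, Complex.exp (ν * u) * (φ u : ℂ)

/-- `φ` is measurable, nonnegative, and decays at least like `e^{-σ|u|}`; its two-sided Laplace
transform is then analytic in the strip `|Re ν| < σ`. -/
structure ExpDecay (σ : ℝ) (φ : ℝ → ℝ) : Prop where
  measurable : Measurable φ
  nonneg : ∀ u, 0 ≤ φ u
  bound : ∃ C, ∀ u, φ u ≤ C * Real.exp (-(σ * |u|))

theorem ExpDecay.integrable_real {σ t : ℝ} {φ : ℝ → ℝ} (hφ : ExpDecay σ φ) (ht : |t| < σ) :
    Integrable fun u : ℝ => Real.exp (t * u) * φ u := by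
  obtain ⟨C, hC⟩ := hφ.bound
  refine ((integrable_exp_neg_mul_abs (sub_pos.mpr ht)).const_mul C).mono'
    ((by fun_prop : Measurable fun u : ℝ => Real.exp (t * u)).mul
      hφ.measurable).aestronglyMeasurable (ae_of_all _ fun u => ?_)
  rw [Real.norm_of_nonneg (mul_nonneg (Real.exp_pos _).le (hφ.nonneg u))]
  calc Real.exp (t * u) * φ u ≤ Real.exp (|t| * |u|) * (C * Real.exp (-(σ * |u|))) := by
        refine mul_le_mul (Real.exp_le_exp.mpr ?_) (hC u) (hφ.nonneg u) (Real.exp_pos _).le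
        rw [← abs_mul]
        exact le_abs_self _
    _ = C * Real.exp (-((σ - |t|) * |u|)) := by
        rw [mul_left_comm, ← Real.exp_add]; ring_nf

theorem norm_cexp_mul_ofReal (ν : ℂ) (u : ℝ) : ‖Complex.exp (ν * u)‖ = Real.exp (ν.re * u) := by
  rw [Complex.norm_exp, Complex.re_mul_ofReal]

theorem ExpDecay.integrable {σ : ℝ} {φ : ℝ → ℝ} (hφ : ExpDecay σ φ) {ν : ℂ} (hν : |ν.re| < σ) :
    Integrable fun u : ℝ => Complex.exp (ν * u) * (φ u : ℂ) := by
  refine (hφ.integrable_real hν).mono'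
    ((by fun_prop : Measurable fun u : ℝ => Complex.exp (ν * u)).mul
      (Complex.measurable_ofReal.comp hφ.measurable)).aestronglyMeasurable (ae_of_all _ fun u => ?_)
  rw [norm_mul, norm_cexp_mul_ofReal, Complex.norm_real, Real.norm_of_nonneg (hφ.nonneg u)]

/-- The transform is the complex moment generating function of the measure with density `φ`. -/
theorem ExpDecay.analyticOnNhd {σ : ℝ} {φ : ℝ → ℝ} (hφ : ExpDecay σ φ) :
    AnalyticOnNhd ℂ (bilateralLaplace φ) {ν | |ν.re| < σ} := by
  set μ : Measure ℝ := volume.withDensity fun u => ENNReal.ofReal (φ u) with hμ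
  have hm : Measurable fun u => ENNReal.ofReal (φ u) := hφ.measurable.ennreal_ofReal
  have htop : ∀ᵐ u : ℝ, ENNReal.ofReal (φ u) < ⊤ := ae_of_all _ fun _ => ENNReal.ofReal_lt_top
  have hsub : Ioo (-σ) σ ⊆ interior (ProbabilityTheory.integrableExpSet id μ) := by
    rw [isOpen_Ioo.subset_interior_iff]
    intro t ht
    refine (integrable_withDensity_iff_integrable_smul' hm htop).mpr ?_
    refine (hφ.integrable_real (abs_lt.mpr ht)).congr (ae_of_all _ fun u => ?_)
    simp [ENNReal.toReal_ofReal (hφ.nonneg u), mul_comm]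
  have heq : bilateralLaplace φ = ProbabilityTheory.complexMGF id μ := by
    ext ν
    rw [ProbabilityTheory.complexMGF, hμ, integral_withDensity_eq_integral_toReal_smul hm htop]
    refine integral_congr_ae (ae_of_all _ fun u => ?_)
    simp [ENNReal.toReal_ofReal (hφ.nonneg u), mul_comm]
  rw [heq]
  exact ProbabilityTheory.analyticOnNhd_complexMGF.mono fun ν hν => hsub (abs_lt.mp hν)

theorem exp_neg_le_factorial_mul {y : ℝ} (hy : 0 < y) (n : ℕ) :
    Real.exp (-y) ≤ n.factorial * (y ^ n)⁻¹ := by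
  have h := Real.pow_div_factorial_le_exp y hy.le n
  rw [Real.exp_neg, ← inv_inv (n.factorial : ℝ), ← mul_inv]
  refine inv_anti₀ (by positivity) ?_
  rwa [mul_comm, ← div_eq_mul_inv]

theorem expDecay_exp_neg_exp {x : ℝ} (hx : 0 < x) (σ : ℝ) :
    ExpDecay σ fun u => Real.exp (-Real.exp u - x * Real.exp (-u)) := by
  refine ⟨by fun_prop, fun u => (Real.exp_pos _).le, ?_⟩
  obtain ⟨n, hn⟩ := exists_nat_ge σ
  have hxn : 0 < (x ^ n)⁻¹ := by positivity
  refine ⟨n.factorial * (1 + (x ^ n)⁻¹), fun u => ?_⟩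
  have hpow : ∀ u : ℝ, (Real.exp u ^ n)⁻¹ = Real.exp (-(n * u)) := fun u => by
    rw [← Real.exp_nat_mul, Real.exp_neg]
  have hmono : Real.exp (-(n * |u|)) ≤ Real.exp (-(σ * |u|)) := by gcongr
  rcases le_total 0 u with hu | hu
  · rw [abs_of_nonneg hu] at *
    calc Real.exp (-Real.exp u - x * Real.exp (-u)) ≤ Real.exp (-Real.exp u) := by
          gcongr; linarith [mul_pos hx (Real.exp_pos (-u))]
      _ ≤ n.factorial * (Real.exp u ^ n)⁻¹ := exp_neg_le_factorial_mul (Real.exp_pos u) n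
      _ ≤ n.factorial * (1 + (x ^ n)⁻¹) * Real.exp (-(σ * u)) := by
          rw [hpow]; gcongr; nlinarith [Nat.cast_pos (α := ℝ).mpr n.factorial_pos]
  · rw [abs_of_nonpos hu] at *
    calc Real.exp (-Real.exp u - x * Real.exp (-u)) ≤ Real.exp (-(x * Real.exp (-u))) := by
          gcongr; linarith [Real.exp_pos u]
      _ ≤ n.factorial * ((x * Real.exp (-u)) ^ n)⁻¹ :=
          exp_neg_le_factorial_mul (mul_pos hx (Real.exp_pos _)) n
      _ = n.factorial * (x ^ n)⁻¹ * Real.exp (-(n * -u)) := by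
          rw [mul_pow, mul_inv, hpow, mul_assoc]
      _ ≤ n.factorial * (1 + (x ^ n)⁻¹) * Real.exp (-(σ * -u)) := by
          gcongr; linarith

/-! ### The integral over `s > 0` of `s^{ν-1} e^{-s-x/s}` -/

/-- `∫ s^{ν-1} e^{-s-x/s} ds` over `s > 0`, written with `s = e^u`. -/
noncomputable def gammaKernel (ν : ℂ) (x : ℝ) : ℂ :=
  bilateralLaplace (fun u => Real.exp (-Real.exp u - x * Real.exp (-u))) ν

theorem integrable_gammaKernel (ν : ℂ) {x : ℝ} (hx : 0 < x) :
    Integrable fun u : ℝ =>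
      Complex.exp (ν * u) * (Real.exp (-Real.exp u - x * Real.exp (-u)) : ℂ) :=
  (expDecay_exp_neg_exp hx (|ν.re| + 1)).integrable (lt_add_one _)

theorem cexp_add_one_mul (ν : ℂ) (u : ℝ) :
    Complex.exp ((ν + 1) * u) = Complex.exp (ν * u) * Real.exp u := by
  rw [Complex.ofReal_exp, ← Complex.exp_add]; ring_nf

theorem cexp_sub_one_mul (ν : ℂ) (u : ℝ) :
    Complex.exp ((ν - 1) * u) = Complex.exp (ν * u) * Real.exp (-u) := by
  rw [Complex.ofReal_exp, ← Complex.exp_add]; push_cast; ring_nf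

/-- Integration by parts. -/
theorem gammaKernel_add_one (ν : ℂ) {x : ℝ} (hx : 0 < x) :
    gammaKernel (ν + 1) x = ν * gammaKernel ν x + x * gammaKernel (ν - 1) x := by
  have i0 := (integrable_gammaKernel ν hx).const_mul ν
  have i1 := integrable_gammaKernel (ν + 1) hx
  have i2 := (integrable_gammaKernel (ν - 1) hx).const_mul (x : ℂ)
  have hd : ∀ u : ℝ, HasDerivAt (fun u : ℝ =>
      Complex.exp (ν * u) * (Real.exp (-Real.exp u - x * Real.exp (-u)) : ℂ))
      (ν * (Complex.exp (ν * u) * (Real.exp (-Real.exp u - x * Real.exp (-u)) : ℂ))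
        + x * (Complex.exp ((ν - 1) * u) * (Real.exp (-Real.exp u - x * Real.exp (-u)) : ℂ))
        - Complex.exp ((ν + 1) * u) * (Real.exp (-Real.exp u - x * Real.exp (-u)) : ℂ)) u := by
    intro u
    have h1 : HasDerivAt (fun u : ℝ => Complex.exp (ν * u)) (Complex.exp (ν * u) * (ν * 1)) u :=
      (((hasDerivAt_id u).ofReal_comp.const_mul ν).cexp)
    have h2 : HasDerivAt (fun u : ℝ => -Real.exp u - x * Real.exp (-u))
        (-Real.exp u - x * (Real.exp (-u) * -1)) u :=
      (Real.hasDerivAt_exp u).neg.sub (((hasDerivAt_id u).neg.exp).const_mul x)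
    refine (h1.mul h2.exp.ofReal_comp).congr_deriv ?_
    rw [cexp_add_one_mul, cexp_sub_one_mul]
    push_cast
    ring
  have i02 : Integrable fun u : ℝ =>
      ν * (Complex.exp (ν * u) * (Real.exp (-Real.exp u - x * Real.exp (-u)) : ℂ))
        + x * (Complex.exp ((ν - 1) * u) * (Real.exp (-Real.exp u - x * Real.exp (-u)) : ℂ)) :=
    i0.add i2
  have h := integral_eq_zero_of_hasDerivAt_of_integrable hd (i02.sub i1)
    (integrable_gammaKernel ν hx)
  rw [integral_sub i02 i1, integral_add i0 i2, integral_const_mul, integral_const_mul]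
    at h
  exact (sub_eq_zero.mp h).symm

theorem hasDerivAt_gammaKernel (ν : ℂ) {x : ℝ} (hx : 0 < x) :
    HasDerivAt (gammaKernel ν) (-gammaKernel (ν - 1) x) x := by
  have hx2 : 0 < x / 2 := by linarith
  have hmeas : ∀ (ν : ℂ) (y : ℝ), AEStronglyMeasurable (fun u : ℝ =>
      Complex.exp (ν * u) * (Real.exp (-Real.exp u - y * Real.exp (-u)) : ℂ)) volume :=
    fun ν y => (by fun_prop : Continuous _).aestronglyMeasurable
  have key := hasDerivAt_integral_of_dominated_loc_of_deriv_le (μ := volume)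
    (F := fun (y : ℝ) (u : ℝ) =>
      Complex.exp (ν * u) * (Real.exp (-Real.exp u - y * Real.exp (-u)) : ℂ))
    (F' := fun (y : ℝ) (u : ℝ) =>
      -(Complex.exp ((ν - 1) * u) * (Real.exp (-Real.exp u - y * Real.exp (-u)) : ℂ)))
    (bound := fun u : ℝ =>
      ‖Complex.exp ((ν - 1) * u) * (Real.exp (-Real.exp u - (x / 2) * Real.exp (-u)) : ℂ)‖)
    (Ioi_mem_nhds (half_lt_self hx)) (Eventually.of_forall fun y => hmeas ν y)
    (integrable_gammaKernel ν hx) (hmeas (ν - 1) x).neg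
    (ae_of_all _ fun u y hy => ?_) (integrable_gammaKernel (ν - 1) hx2).norm
    (ae_of_all _ fun u y _ => ?_)
  · refine key.2.congr_deriv ?_
    rw [integral_neg]; rfl
  · rw [norm_neg, norm_mul, norm_mul, Complex.norm_real, Complex.norm_real,
      Real.norm_of_nonneg (Real.exp_pos _).le, Real.norm_of_nonneg (Real.exp_pos _).le]
    have := (mem_Ioi.mp hy).le
    gcongr
  · have h2 : HasDerivAt (fun y : ℝ => -Real.exp u - y * Real.exp (-u))
        (-(1 * Real.exp (-u))) y :=
      ((hasDerivAt_id y).mul_const _).const_sub _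
    refine (h2.exp.ofReal_comp.const_mul (Complex.exp (ν * u))).congr_deriv ?_
    rw [cexp_sub_one_mul]
    push_cast
    ring

theorem integral_Ioi_eq_integral_comp_exp {E : Type*} [NormedAddCommGroup E] [NormedSpace ℝ E]
    (f : ℝ → E) : ∫ t in Ioi (0 : ℝ), f t = ∫ u : ℝ, Real.exp u • f (Real.exp u) := by
  have h := integral_image_eq_integral_abs_deriv_smul MeasurableSet.univ
    (fun u _ => (Real.hasDerivAt_exp u).hasDerivWithinAt) Real.exp_injective.injOn f
  rw [image_univ, Real.range_exp, Measure.restrict_univ] at h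
  simpa only [abs_of_pos (Real.exp_pos _)] using h

theorem integrableOn_Ioi_iff_integrable_comp_exp {E : Type*} [NormedAddCommGroup E]
    [NormedSpace ℝ E] (f : ℝ → E) :
    IntegrableOn f (Ioi 0) ↔ Integrable fun u : ℝ => Real.exp u • f (Real.exp u) := by
  have h := integrableOn_image_iff_integrableOn_abs_deriv_smul MeasurableSet.univ
    (fun u _ => (Real.hasDerivAt_exp u).hasDerivWithinAt) Real.exp_injective.injOn f
  rw [image_univ, Real.range_exp, integrableOn_univ] at h
  simpa only [abs_of_pos (Real.exp_pos _)] using h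

theorem cpow_exp_sub_one (ν : ℂ) (u : ℝ) :
    (Real.exp u : ℂ) * (Real.exp u : ℂ) ^ (ν - 1) = Complex.exp (ν * u) := by
  have h0 : (Real.exp u : ℂ) ≠ 0 := by exact_mod_cast (Real.exp_pos u).ne'
  rw [Complex.cpow_sub _ _ h0, Complex.cpow_one, mul_div_cancel₀ _ h0,
    Complex.cpow_def_of_ne_zero h0, ← Complex.ofReal_log (Real.exp_pos u).le, Real.log_exp,
    mul_comm]

theorem integral_exp_neg_exp {ν : ℂ} (hν : 0 < ν.re) :
    (Integrable fun u : ℝ => Complex.exp (ν * u) * (Real.exp (-Real.exp u) : ℂ)) ∧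
      ∫ u : ℝ, Complex.exp (ν * u) * (Real.exp (-Real.exp u) : ℂ) = Complex.Gamma ν := by
  have hpt : ∀ u : ℝ, Real.exp u • ((Real.exp (-Real.exp u) : ℂ) * (Real.exp u : ℂ) ^ (ν - 1)) =
      Complex.exp (ν * u) * (Real.exp (-Real.exp u) : ℂ) := fun u => by
    rw [Complex.real_smul, mul_left_comm, cpow_exp_sub_one, mul_comm]
  have h1 := (integrableOn_Ioi_iff_integrable_comp_exp _).mp
    (Complex.GammaIntegral_convergent hν)
  have h2 := integral_Ioi_eq_integral_comp_exp
    fun t : ℝ => (Real.exp (-t) : ℂ) * (t : ℂ) ^ (ν - 1)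
  simp only [hpt] at h1 h2
  refine ⟨h1, ?_⟩
  rw [← h2, Complex.Gamma_eq_integral hν, Complex.GammaIntegral]

/-- As `x ↓ 0` the integral becomes Euler's integral for `Γ(ν)`. -/
theorem tendsto_gammaKernel_zero {ν : ℂ} (hν : 0 < ν.re) :
    Tendsto (gammaKernel ν) (𝓝[>] 0) (𝓝 (Complex.Gamma ν)) := by
  obtain ⟨hi, he⟩ := integral_exp_neg_exp hν
  rw [← he]
  refine tendsto_integral_filter_of_dominated_convergence
    (fun u => ‖Complex.exp (ν * u) * (Real.exp (-Real.exp u) : ℂ)‖) ?_ ?_ hi.norm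
    (ae_of_all _ fun u => ?_)
  · exact Eventually.of_forall fun y => (by fun_prop : Continuous _).aestronglyMeasurable
  · filter_upwards [self_mem_nhdsWithin] with y hy
    refine ae_of_all _ fun u => ?_
    rw [norm_mul, norm_mul, Complex.norm_real, Complex.norm_real,
      Real.norm_of_nonneg (Real.exp_pos _).le, Real.norm_of_nonneg (Real.exp_pos _).le]
    gcongr
    linarith [mul_pos (mem_Ioi.mp hy) (Real.exp_pos (-u))]
  · have : Continuous fun y : ℝ =>
        Complex.exp (ν * u) * (Real.exp (-Real.exp u - y * Real.exp (-u)) : ℂ) := by fun_prop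
    simpa using (this.tendsto 0).mono_left nhdsWithin_le_nhds

/-- The substitution `s ↦ x / s`. -/
theorem gammaKernel_neg (ν : ℂ) {x : ℝ} (hx : 0 < x) :
    gammaKernel ν x = (x : ℂ) ^ ν * gammaKernel (-ν) x := by
  have hx0 : (x : ℂ) ≠ 0 := by exact_mod_cast hx.ne'
  unfold gammaKernel bilateralLaplace
  rw [← integral_const_mul, ← integral_sub_left_eq_self _ volume (Real.log x)]
  refine integral_congr_ae (ae_of_all _ fun u => ?_)
  simp only
  rw [Complex.cpow_def_of_ne_zero hx0, ← Complex.ofReal_log hx.le, ← mul_assoc, ← Complex.exp_add]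
  congr 2
  · push_cast; ring
  · congr 1
    rw [neg_sub, Real.exp_sub, Real.exp_sub, Real.exp_neg, Real.exp_log hx]
    field_simp
    ring

/-! ### The integral representation of `K_ν` on the positive axis -/

/-- The left-hand side has derivative zero in `x`, and its limit as `x ↓ 0` is `Γ(ν) / Γ(ν) = 1`. -/
theorem gammaKernel_wronskian_of_re_pos {ν : ℂ} (hν : 0 < ν.re) {x : ℝ} (hx : 0 < x) :
    gammaKernel ν x * besselSeries (ν - 1) x + x * gammaKernel (ν - 1) x * besselSeries ν x = 1 := by
  set f : ℝ → ℂ := fun x =>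
    gammaKernel ν x * besselSeries (ν - 1) x + x * gammaKernel (ν - 1) x * besselSeries ν x
  have hderiv : ∀ x ∈ Ioi (0 : ℝ), HasDerivAt f 0 x := by
    intro x hx
    have hE := fun ν => (hasDerivAt_besselSeries ν x).comp_ofReal
    have hG := fun ν => hasDerivAt_gammaKernel ν (mem_Ioi.mp hx)
    have h := ((hG ν).mul (hE (ν - 1))).add
      ((((hasDerivAt_id x).ofReal_comp).mul (hG (ν - 1))).mul (hE ν))
    refine h.congr_deriv ?_
    have e1 := besselSeries_sub_one ν x
    have e2 := gammaKernel_add_one (ν - 1) (mem_Ioi.mp hx)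
    rw [sub_add_cancel] at e2 ⊢
    simp only [id, Pi.mul_apply, Complex.ofReal_one]
    rw [e1, e2]
    ring
  have hconst : ∀ y ∈ Ioi (0 : ℝ), f y = f x := fun y hy =>
    isOpen_Ioi.is_const_of_deriv_eq_zero isPreconnected_Ioi
      (fun y hy => (hderiv y hy).differentiableAt.differentiableWithinAt)
      (fun y hy => (hderiv y hy).deriv) hy hx
  have hlim1 : Tendsto f (𝓝[>] 0) (𝓝 (f x)) :=
    tendsto_const_nhds.congr' (eventually_nhdsWithin_of_forall fun y hy => (hconst y hy).symm)
  have hEc : ∀ ν, Tendsto (fun y : ℝ => besselSeries ν y) (𝓝[>] 0) (𝓝 (Complex.Gamma (ν + 1))⁻¹) := by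
    intro ν
    have h := ((hasDerivAt_besselSeries ν (0 : ℝ)).continuousAt.comp
      Complex.continuous_ofReal.continuousAt).tendsto.mono_left
        (nhdsWithin_le_nhds (s := Ioi (0 : ℝ)))
    simpa [besselSeries_zero_right, Function.comp_def] using h
  have hν0 : ν ≠ 0 := by rintro rfl; simp at hν
  have hxg : Tendsto (fun y : ℝ => (y : ℂ) * gammaKernel (ν - 1) y) (𝓝[>] 0) (𝓝 0) := by
    have h := (tendsto_gammaKernel_zero (ν := ν + 1) (by simp; linarith)).sub
      ((tendsto_gammaKernel_zero hν).const_mul ν)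
    rw [Complex.Gamma_add_one _ hν0, sub_self] at h
    refine h.congr' (eventually_nhdsWithin_of_forall fun y hy => ?_)
    rw [gammaKernel_add_one ν (mem_Ioi.mp hy)]
    ring
  have hlim2 := ((tendsto_gammaKernel_zero hν).mul (hEc (ν - 1))).add (hxg.mul (hEc ν))
  rw [sub_add_cancel, mul_inv_cancel₀ (Complex.Gamma_ne_zero_of_re_pos hν), zero_mul, add_zero]
    at hlim2
  exact tendsto_nhds_unique hlim1 hlim2

/-- The Wronskian of the integral with `I_ν`. The left-hand side does not change when `ν` is
increased by `1`, so the case `Re ν > 0` suffices. -/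
theorem gammaKernel_wronskian (ν : ℂ) {x : ℝ} (hx : 0 < x) :
    gammaKernel ν x * besselSeries (ν - 1) x + x * gammaKernel (ν - 1) x * besselSeries ν x = 1 := by
  obtain ⟨n, hn⟩ := exists_nat_gt (-ν.re)
  induction n generalizing ν with
  | zero => exact gammaKernel_wronskian_of_re_pos (by simpa using hn) hx
  | succ n ih =>
    have h := ih (ν + 1) (by push_cast at hn; simp; linarith)
    rw [add_sub_cancel_right, gammaKernel_add_one ν hx] at h
    rw [besselSeries_sub_one]
    linear_combination h

/-- The integral as a combination of `I_{-ν}` and `I_ν`: solve the two Wronskian relations, at `ν`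
and at `1 - ν`, for the integral. -/
theorem gammaKernel_mul_sin (ν : ℂ) {x : ℝ} (hx : 0 < x) :
    gammaKernel ν x * (Complex.sin (Real.pi * ν) / Real.pi) =
      besselSeries (-ν) x - (x : ℂ) ^ ν * besselSeries ν x := by
  have hx0 : (x : ℂ) ≠ 0 := by exact_mod_cast hx.ne'
  have h1 := gammaKernel_wronskian ν hx
  have h2 := gammaKernel_wronskian (1 - ν) hx
  have h3 := gammaKernel_neg ν hx
  have h4 := gammaKernel_neg (ν - 1) hx
  rw [Complex.cpow_sub _ _ hx0, Complex.cpow_one, neg_sub] at h4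
  rw [show (1 - ν - 1 : ℂ) = -ν by ring] at h2
  have h5 : x * gammaKernel (ν - 1) x * besselSeries (-ν) x
      + x * gammaKernel ν x * besselSeries (1 - ν) x = (x : ℂ) ^ ν := by
    rw [h4, h3]
    linear_combination (x : ℂ) ^ ν * h2
      + (x : ℂ) ^ ν * gammaKernel (1 - ν) x * besselSeries (-ν) x * (mul_inv_cancel₀ hx0)
  rw [← besselSeries_wronskian ν x]
  linear_combination besselSeries (-ν) x * h1 - besselSeries ν x * h5

theorem expDecay_exp_neg_cosh {x : ℝ} (hx : 0 < x) (σ : ℝ) :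
    ExpDecay σ fun u => Real.exp (-(x * Real.cosh u)) := by
  refine ⟨by fun_prop, fun u => (Real.exp_pos _).le, ?_⟩
  obtain ⟨n, hn⟩ := exists_nat_ge σ
  refine ⟨n.factorial * ((x / 2) ^ n)⁻¹, fun u => ?_⟩
  have hx2 : 0 < x / 2 := half_pos hx
  have hmono : Real.exp (-(n * |u|)) ≤ Real.exp (-(σ * |u|)) := by gcongr
  calc Real.exp (-(x * Real.cosh u)) ≤ Real.exp (-(x / 2 * Real.exp |u|)) := by
        rw [← Real.cosh_abs u, Real.cosh_eq, div_mul_eq_mul_div, mul_div_assoc]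
        gcongr
        linarith [Real.exp_pos (-|u|)]
    _ ≤ n.factorial * ((x / 2 * Real.exp |u|) ^ n)⁻¹ :=
        exp_neg_le_factorial_mul (mul_pos hx2 (Real.exp_pos _)) n
    _ = n.factorial * ((x / 2) ^ n)⁻¹ * Real.exp (-(n * |u|)) := by
        rw [mul_pow, mul_inv, ← Real.exp_nat_mul, Real.exp_neg, mul_assoc]
    _ ≤ n.factorial * ((x / 2) ^ n)⁻¹ * Real.exp (-(σ * |u|)) := by gcongr

/-- The integral `½ ∫ e^{νu - x cosh u} du` over the real line, which represents `K_ν(x)` for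
`x > 0` and all orders `ν`. -/
noncomputable def macdonaldIntegral (ν : ℂ) (x : ℝ) : ℂ :=
  1 / 2 * bilateralLaplace (fun u => Real.exp (-(x * Real.cosh u))) ν

theorem differentiable_macdonaldIntegral {x : ℝ} (hx : 0 < x) :
    Differentiable ℂ fun ν => macdonaldIntegral ν x := fun ν =>
  ((expDecay_exp_neg_cosh hx (|ν.re| + 1)).analyticOnNhd ν
    (lt_add_one |ν.re|)).differentiableAt.const_mul _

/-- The substitution `u ↦ u - log (x/2)`. -/
theorem two_mul_macdonaldIntegral (ν : ℂ) {x : ℝ} (hx : 0 < x) :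
    2 * macdonaldIntegral ν x = ((x / 2 : ℝ) : ℂ) ^ (-ν) * gammaKernel ν ((x / 2) ^ 2) := by
  have hx2 : 0 < x / 2 := half_pos hx
  have hx0 : ((x / 2 : ℝ) : ℂ) ≠ 0 := by exact_mod_cast hx2.ne'
  unfold gammaKernel macdonaldIntegral bilateralLaplace
  rw [← mul_assoc, mul_one_div_cancel two_ne_zero, one_mul,
    ← integral_sub_right_eq_self _ (Real.log (x / 2)), ← integral_const_mul]
  refine integral_congr_ae (ae_of_all _ fun u => ?_)
  simp only
  rw [Complex.cpow_def_of_ne_zero hx0, ← Complex.ofReal_log hx2.le, ← mul_assoc, ← Complex.exp_add]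
  congr 2
  · push_cast; ring
  · congr 1
    rw [Real.cosh_eq, neg_sub, Real.exp_sub, Real.exp_sub, Real.exp_neg, Real.exp_log hx2]
    field_simp
    ring

theorem besselK_of_not_int {ν : ℂ} (hν : ¬∃ n : ℤ, ν = n) (z : ℂ) :
    besselK ν z =
      (Real.pi : ℂ) / 2 * (besselI (-ν) z - besselI ν z) / Complex.sin (Real.pi * ν) := by
  rw [besselK, if_neg hν]

theorem eventually_not_int (ν : ℂ) : ∀ᶠ μ : ℂ in 𝓝[≠] ν, ¬∃ n : ℤ, μ = n := by
  have hc : IsClosed (range ((↑) : ℤ → ℂ) \ {ν}) := by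
    have : IsClosed ((↑) '' ({n : ℤ | (n : ℂ) ≠ ν}) : Set ℂ) :=
      Complex.isClosedEmbedding_intCast.isClosedMap _ (isClosed_discrete _)
    convert this using 1
    ext μ
    constructor
    · rintro ⟨⟨n, rfl⟩, h⟩; exact ⟨n, h, rfl⟩
    · rintro ⟨n, h, rfl⟩; exact ⟨⟨n, rfl⟩, h⟩
  have hmem : (range ((↑) : ℤ → ℂ) \ {ν})ᶜ ∈ 𝓝 ν := hc.isOpen_compl.mem_nhds (by simp)
  filter_upwards [mem_nhdsWithin_of_mem_nhds hmem, self_mem_nhdsWithin] with μ h1 h2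
  rintro ⟨n, rfl⟩
  exact h1 ⟨⟨n, rfl⟩, h2⟩

/-- A formula for `K_μ(z)` at the orders that are no integers extends by continuity to
all orders. -/
theorem besselK_eq_of_continuousAt {F : ℂ → ℂ} {ν z : ℂ} (hF : ContinuousAt F ν)
    (h : ∀ᶠ μ : ℂ in 𝓝 ν, (¬∃ n : ℤ, μ = n) → besselK μ z = F μ) : besselK ν z = F ν := by
  by_cases hν : ∃ n : ℤ, ν = n
  · rw [besselK, if_pos hν]
    refine Tendsto.limUnder_eq ((hF.tendsto.mono_left nhdsWithin_le_nhds).congr' ?_)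
    filter_upwards [mem_nhdsWithin_of_mem_nhds h, eventually_not_int ν] with μ h1 h2
    rw [← h1 h2, besselK_of_not_int h2]
  · exact h.self_of_nhds hν

/-- The integral representation of `K_ν` on the positive axis. -/
theorem besselK_ofReal (ν : ℂ) {x : ℝ} (hx : 0 < x) : besselK ν x = macdonaldIntegral ν x := by
  refine besselK_eq_of_continuousAt
    (differentiable_macdonaldIntegral hx).continuous.continuousAt (Eventually.of_forall ?_)
  intro ν hν
  have hx2 : 0 < x / 2 := half_pos hx
  have hx0 : ((x / 2 : ℝ) : ℂ) ≠ 0 := by exact_mod_cast hx2.ne'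
  have hs : Complex.sin (Real.pi * ν) ≠ 0 :=
    sin_pi_mul_ne_zero fun ⟨n, hn⟩ => hν ⟨n, hn.symm⟩
  have hpi : (Real.pi : ℂ) ≠ 0 := by exact_mod_cast Real.pi_ne_zero
  have h1 := two_mul_macdonaldIntegral ν hx
  have h2 := gammaKernel_mul_sin ν (x := (x / 2) ^ 2) (by positivity)
  have h3 : (((x / 2) ^ 2 : ℝ) : ℂ) ^ ν = ((x / 2 : ℝ) : ℂ) ^ ν * ((x / 2 : ℝ) : ℂ) ^ ν := by
    rw [sq, Complex.ofReal_mul, Complex.mul_cpow_ofReal_nonneg hx2.le hx2.le]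
  have h4 : ((x / 2 : ℝ) : ℂ) ^ (-ν) * ((x / 2 : ℝ) : ℂ) ^ ν = 1 := by
    rw [← Complex.cpow_add _ _ hx0]; simp
  rw [besselK_of_not_int hν, besselI_eq, besselI_eq,
    show ((x : ℂ) / 2) = ((x / 2 : ℝ) : ℂ) by push_cast; ring,
    show ((x : ℂ) ^ 2 / 4) = (((x / 2) ^ 2 : ℝ) : ℂ) by push_cast; ring]
  rw [h3, ← mul_div_assoc, div_eq_iff hpi] at h2
  rw [div_eq_iff hs]
  linear_combination (-(Complex.sin (Real.pi * ν)) / 2) * h1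
    - ((x / 2 : ℝ) : ℂ) ^ (-ν) / 2 * h2
    + Real.pi / 2 * ((x / 2 : ℝ) : ℂ) ^ ν * besselSeries ν (((x / 2) ^ 2 : ℝ) : ℂ) * h4

/-! ### Interchanging the integrals -/

/-- The function `(2 cosh(u/2))^{-(2n+1)}`. -/
noncomputable def sechPow (n : ℕ) (u : ℝ) : ℝ := ((2 * Real.cosh (u / 2)) ^ (2 * n + 1))⁻¹

theorem sechPow_pos (n : ℕ) (u : ℝ) : 0 < sechPow n u := by
  have := Real.cosh_pos (u / 2)
  unfold sechPow
  positivity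

theorem expDecay_sechPow (n : ℕ) : ExpDecay ((n : ℝ) + 1 / 2) (sechPow n) := by
  refine ⟨by unfold sechPow; fun_prop, fun u => (sechPow_pos n u).le, 1, fun u => ?_⟩
  have h1 : Real.exp (|u| / 2) ≤ 2 * Real.cosh (u / 2) := by
    rw [← Real.cosh_abs, abs_div, abs_of_pos (two_pos (α := ℝ)), Real.cosh_eq]
    linarith [Real.exp_pos (-(|u| / 2))]
  rw [one_mul, sechPow, Real.exp_neg]
  refine inv_anti₀ (Real.exp_pos _) ?_
  calc Real.exp (((n : ℝ) + 1 / 2) * |u|) = Real.exp (|u| / 2) ^ (2 * n + 1) := by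
        rw [← Real.exp_nat_mul]; push_cast; ring_nf
    _ ≤ (2 * Real.cosh (u / 2)) ^ (2 * n + 1) := by gcongr

/-- Euler's beta integral, in the variable `u` with `x = 1 / (1 + e^{-u})`. -/
theorem bilateralLaplace_sechPow {n : ℕ} {ν : ℂ} (hν : |ν.re| < (n : ℝ) + 1 / 2) :
    bilateralLaplace (sechPow n) ν * (2 * n).factorial =
      Complex.Gamma (n + 1 / 2 + ν) * Complex.Gamma (n + 1 / 2 - ν) := by
  obtain ⟨h1, h2⟩ := abs_lt.mp hν
  have hre : ((n : ℂ) + 1 / 2).re = (n : ℝ) + 1 / 2 := by simp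
  have hG := Complex.Gamma_mul_Gamma_eq_betaIntegral (s := n + 1 / 2 + ν) (t := n + 1 / 2 - ν)
    (by rw [Complex.add_re, hre]; linarith) (by rw [Complex.sub_re, hre]; linarith)
  rw [hG, show (n + 1 / 2 + ν + (n + 1 / 2 - ν) : ℂ) = ((2 * n : ℕ) : ℂ) + 1 by push_cast; ring,
    Complex.Gamma_nat_eq_factorial, mul_comm]
  congr 1
  rw [Complex.betaIntegral, intervalIntegral.integral_of_le zero_le_one,
    integral_Ioc_eq_integral_Ioo, ← Real.range_sigmoid, ← image_univ,
    integral_image_eq_integral_abs_deriv_smul MeasurableSet.univ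
      (fun u _ => (Real.hasDerivAt_sigmoid u).hasDerivWithinAt) Real.sigmoid_injective.injOn,
    Measure.restrict_univ]
  refine integral_congr_ae (ae_of_all _ fun u => ?_)
  simp only
  have hs0 := Real.sigmoid_pos u
  have hs1 : 0 < 1 - Real.sigmoid u := by linarith [Real.sigmoid_lt_one u]
  have hpow : ∀ (x : ℝ) (a : ℂ), 0 < x → (x : ℂ) * (x : ℂ) ^ (a - 1) = Complex.exp (Real.log x * a) := by
    intro x a hx
    have hx0 : (x : ℂ) ≠ 0 := by exact_mod_cast hx.ne'
    rw [Complex.cpow_sub _ _ hx0, Complex.cpow_one, mul_div_cancel₀ _ hx0,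
      Complex.cpow_def_of_ne_zero hx0, Complex.ofReal_log hx.le]
  rw [abs_of_pos (mul_pos hs0 hs1), Complex.real_smul, Complex.ofReal_mul, mul_mul_mul_comm,
    show (1 : ℂ) - (Real.sigmoid u : ℂ) = ((1 - Real.sigmoid u : ℝ) : ℂ) by push_cast; ring,
    hpow _ _ hs0, hpow _ _ hs1]
  set c := 2 * Real.cosh (u / 2) with hc
  have hc0 : 0 < c := mul_pos two_pos (Real.cosh_pos _)
  have e1 : Real.sigmoid u = Real.exp (u / 2) / c := by
    rw [Real.sigmoid_def, hc, Real.cosh_eq, inv_eq_one_div, div_eq_div_iff (by positivity) (by positivity)]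
    have : Real.exp (-u) = Real.exp (-(u / 2)) * Real.exp (-(u / 2)) := by
      rw [← Real.exp_add]; ring_nf
    rw [this, Real.exp_neg]
    field_simp
  have e2 : 1 - Real.sigmoid u = Real.exp (-(u / 2)) / c := by
    rw [e1, hc, Real.cosh_eq]
    field_simp
    ring
  rw [e2, e1, Real.log_div (Real.exp_pos _).ne' hc0.ne', Real.log_div (Real.exp_pos _).ne' hc0.ne',
    Real.log_exp, Real.log_exp, sechPow, ← hc, ← Real.exp_log hc0, ← Real.exp_nat_mul,
    ← Real.exp_neg, Complex.ofReal_exp, ← Complex.exp_add, ← Complex.exp_add, Real.log_exp]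
  congr 1
  push_cast
  ring

/-- The weight `t^{N-1/2} e^{-t}`. -/
noncomputable def besselWeight (N : ℕ) (t : ℝ) : ℝ := t ^ ((N : ℝ) - 1 / 2) * Real.exp (-t)

theorem besselWeight_pos (N : ℕ) {t : ℝ} (ht : 0 < t) : 0 < besselWeight N t :=
  mul_pos (Real.rpow_pos_of_pos ht _) (Real.exp_pos _)

@[fun_prop]
theorem measurable_besselWeight (N : ℕ) : Measurable (besselWeight N) := by
  unfold besselWeight; fun_prop

theorem besselWeight_succ (N : ℕ) {t : ℝ} (ht : 0 < t) :
    besselWeight (N + 1) t = t * besselWeight N t := by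
  unfold besselWeight
  rw [show ((N + 1 : ℕ) : ℝ) - 1 / 2 = 1 + ((N : ℝ) - 1 / 2) by push_cast; ring,
    Real.rpow_add ht, Real.rpow_one, mul_assoc]

theorem integral_besselWeight_mul_exp (N : ℕ) (u : ℝ) :
    ∫ t in Ioi (0 : ℝ), besselWeight N t * Real.exp (-(t * Real.cosh u)) =
      Real.Gamma (N + 1 / 2) * 2 ^ ((N : ℝ) + 1 / 2) * sechPow N u := by
  have hN : (0 : ℝ) < (N : ℝ) + 1 / 2 := by positivity
  have hc := Real.cosh_pos u
  have h := Real.integral_rpow_mul_exp_neg_mul_Ioi (a := (N : ℝ) + 1 / 2) (r := 1 + Real.cosh u)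
    hN (by positivity)
  have h2 : 1 + Real.cosh u = (2 * Real.cosh (u / 2)) ^ 2 / 2 := by
    have := Real.cosh_two_mul (u / 2)
    rw [mul_div_cancel₀ u two_ne_zero] at this
    rw [this, Real.sinh_sq]; ring
  have hc2 := Real.cosh_pos (u / 2)
  have h3 : (1 / (1 + Real.cosh u)) ^ ((N : ℝ) + 1 / 2) = 2 ^ ((N : ℝ) + 1 / 2) * sechPow N u := by
    rw [h2, one_div_div, Real.div_rpow two_pos.le (by positivity), ← Real.rpow_natCast _ 2,
      ← Real.rpow_mul (by positivity),
      show ((2 : ℕ) : ℝ) * ((N : ℝ) + 1 / 2) = ((2 * N + 1 : ℕ) : ℝ) by push_cast; ring,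
      Real.rpow_natCast, sechPow, div_eq_mul_inv]
  rw [h3] at h
  rw [mul_assoc, mul_comm, ← h]
  refine setIntegral_congr_fun measurableSet_Ioi fun t _ => ?_
  simp only [besselWeight]
  rw [mul_assoc, ← Real.exp_add]
  ring_nf

theorem integrableOn_besselWeight_mul_exp (N : ℕ) (u : ℝ) :
    IntegrableOn (fun t => besselWeight N t * Real.exp (-(t * Real.cosh u))) (Ioi 0) := by
  refine Integrable.of_integral_ne_zero ?_
  rw [integral_besselWeight_mul_exp]
  have := Real.Gamma_pos_of_pos (s := (N : ℝ) + 1 / 2) (by positivity)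
  have := sechPow_pos N u
  positivity

/-- The integrability behind every interchange of the `t`- and the `u`-integral. The strip of
orders is exactly where `(1 + cosh u)^{-(N+1/2)}`, the `t`-integral, beats `e^{νu}`. -/
theorem integrable_prod_besselWeight {N : ℕ} {ν : ℂ} (hν : |ν.re| < (N : ℝ) + 1 / 2)
    {k : ℝ → ℝ} (hk : Measurable k) (hk1 : ∀ t, |k t| ≤ 1) :
    Integrable (fun p : ℝ × ℝ => Complex.exp (ν * p.2) *
      ((besselWeight N p.1 * Real.exp (-(p.1 * Real.cosh p.2)) * k p.1 : ℝ) : ℂ))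
      ((volume.restrict (Ioi 0)).prod volume) := by
  have hmono : Integrable (fun p : ℝ × ℝ => Real.exp (ν.re * p.2) *
      (besselWeight N p.1 * Real.exp (-(p.1 * Real.cosh p.2))))
      ((volume.restrict (Ioi 0)).prod volume) := by
    refine (integrable_prod_iff' (by fun_prop : Measurable _).aestronglyMeasurable).mpr ⟨?_, ?_⟩
    · exact ae_of_all _ fun u =>
        (integrableOn_besselWeight_mul_exp N u).const_mul (Real.exp (ν.re * u))
    · refine (((expDecay_sechPow N).integrable_real hν).const_mul
        (Real.Gamma (N + 1 / 2) * 2 ^ ((N : ℝ) + 1 / 2))).congr (ae_of_all _ fun u => ?_)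
      simp only
      rw [mul_left_comm, ← integral_besselWeight_mul_exp, ← integral_const_mul]
      refine setIntegral_congr_fun measurableSet_Ioi fun t ht => ?_
      have := besselWeight_pos N (mem_Ioi.mp ht)
      exact (Real.norm_of_nonneg (by positivity)).symm
  refine hmono.mono (by fun_prop : Measurable _).aestronglyMeasurable (ae_of_all _ fun p => ?_)
  rw [norm_mul, norm_mul, norm_cexp_mul_ofReal, Complex.norm_real,
    Real.norm_of_nonneg (Real.exp_pos _).le]
  gcongr
  rw [norm_mul]
  exact mul_le_of_le_one_right (norm_nonneg _) (hk1 p.1)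

/-- The integral over `t > 0` that remains when `K_ν(t)` is replaced by the integrand `e^{-t cosh u}`
of its integral representation, and the order of integration is reversed. -/
noncomputable def weightKernel (N : ℕ) (k : ℝ → ℝ) (u : ℝ) : ℝ :=
  ∫ t in Ioi (0 : ℝ), besselWeight N t * Real.exp (-(t * Real.cosh u)) * k t

theorem weightKernel_one (N : ℕ) (u : ℝ) : weightKernel N (fun _ => 1) u =
    Real.Gamma (N + 1 / 2) * 2 ^ ((N : ℝ) + 1 / 2) * sechPow N u := by
  simp only [weightKernel, mul_one, integral_besselWeight_mul_exp]

theorem expDecay_weightKernel (N : ℕ) {k : ℝ → ℝ} (hk : Measurable k)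
    (hk0 : ∀ t, 0 < t → 0 ≤ k t) (hk1 : ∀ t, |k t| ≤ 1) :
    ExpDecay ((N : ℝ) + 1 / 2) (weightKernel N k) := by
  obtain ⟨C, hC⟩ := (expDecay_sechPow N).bound
  refine ⟨?_, fun u => ?_, Real.Gamma (N + 1 / 2) * 2 ^ ((N : ℝ) + 1 / 2) * C, fun u => ?_⟩
  · have : Measurable fun p : ℝ × ℝ =>
      besselWeight N p.2 * Real.exp (-(p.2 * Real.cosh p.1)) * k p.2 := by fun_prop
    exact this.stronglyMeasurable.integral_prod_right'.measurable
  · refine setIntegral_nonneg measurableSet_Ioi fun t ht => ?_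
    have := besselWeight_pos N (mem_Ioi.mp ht)
    exact mul_nonneg (by positivity) (hk0 t ht)
  · have h1 : weightKernel N k u ≤ weightKernel N (fun _ => 1) u := by
      unfold weightKernel
      have hi := integrableOn_besselWeight_mul_exp N u
      refine setIntegral_mono_on (Integrable.mono hi (by fun_prop : Measurable _).aestronglyMeasurable
        (ae_of_all _ fun t => ?_)) (by simpa using hi) measurableSet_Ioi fun t ht => ?_
      · rw [norm_mul]; exact mul_le_of_le_one_right (norm_nonneg _) (hk1 t)
      · have := besselWeight_pos N (mem_Ioi.mp ht)
        gcongr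
        exact (le_abs_self _).trans (hk1 t)
    refine h1.trans ?_
    have := Real.Gamma_pos_of_pos (s := (N : ℝ) + 1 / 2) (by positivity)
    rw [weightKernel_one, mul_assoc _ C]
    gcongr
    exact hC u

theorem integral_cexp_mul_besselWeight (ν : ℂ) (N : ℕ) (k : ℝ → ℝ) (t : ℝ) :
    ∫ u : ℝ, Complex.exp (ν * u) *
      ((besselWeight N t * Real.exp (-(t * Real.cosh u)) * k t : ℝ) : ℂ) =
    2 * ((besselWeight N t * k t : ℝ) * macdonaldIntegral ν t) := by
  rw [macdonaldIntegral, bilateralLaplace, mul_left_comm, ← mul_assoc 2,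
    mul_one_div_cancel two_ne_zero, one_mul, ← integral_const_mul]
  refine integral_congr_ae (ae_of_all _ fun u => ?_)
  push_cast
  ring

theorem integrableOn_besselWeight_mul_macdonaldIntegral {N : ℕ} {ν : ℂ}
    (hν : |ν.re| < (N : ℝ) + 1 / 2) :
    IntegrableOn (fun t => (besselWeight N t : ℂ) * macdonaldIntegral ν t) (Ioi 0) := by
  have h := (integrable_prod_besselWeight hν (k := fun _ => 1) measurable_const
    (by simp)).integral_prod_left.const_mul (1 / 2)
  refine h.congr (ae_of_all _ fun t => ?_)
  have h1 := integral_cexp_mul_besselWeight ν N (fun _ => 1) t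
  simp only at h1 ⊢
  rw [h1, ← mul_assoc, one_div_mul_cancel two_ne_zero, one_mul, mul_one]

theorem integral_besselWeight_mul_macdonaldIntegral {N : ℕ} {ν : ℂ}
    (hν : |ν.re| < (N : ℝ) + 1 / 2) {k : ℝ → ℝ} (hk : Measurable k) (hk1 : ∀ t, |k t| ≤ 1) :
    ∫ t in Ioi (0 : ℝ), ((besselWeight N t * k t : ℝ) : ℂ) * macdonaldIntegral ν t =
      1 / 2 * bilateralLaplace (weightKernel N k) ν := by
  have h := integral_integral_swap (f := fun t u : ℝ => Complex.exp (ν * u) *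
      ((besselWeight N t * Real.exp (-(t * Real.cosh u)) * k t : ℝ) : ℂ))
    (integrable_prod_besselWeight hν hk hk1)
  simp only [integral_cexp_mul_besselWeight] at h
  rw [integral_const_mul] at h
  have h2 : bilateralLaplace (weightKernel N k) ν =
      2 * ∫ t in Ioi (0 : ℝ), ((besselWeight N t * k t : ℝ) : ℂ) * macdonaldIntegral ν t := by
    rw [h]
    unfold bilateralLaplace weightKernel
    refine integral_congr_ae (ae_of_all _ fun u => ?_)
    simp only
    rw [integral_const_mul, integral_complex_ofReal]
  rw [h2, ← mul_assoc, one_div_mul_cancel two_ne_zero, one_mul]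

/-! ### Moments and the Stieltjes transform of the weight -/

/-- The constant `(2/π)^{1/2} cos(πν)/π` in front of the integral for the remainder. -/
noncomputable def remainderConst (ν : ℂ) : ℂ :=
  (2 / (Real.pi : ℂ)) ^ (1 / 2 : ℂ) * (Complex.cos (Real.pi * ν) / Real.pi)

theorem two_div_pi_cpow : (2 / (Real.pi : ℂ)) ^ (1 / 2 : ℂ) = (Real.sqrt (2 / Real.pi) : ℂ) := by
  rw [Real.sqrt_eq_rpow, Complex.ofReal_cpow (by positivity)]
  push_cast
  rfl

theorem hankelCoeff_succ (n : ℕ) (ν : ℂ) :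
    hankelCoeff (n + 1) ν * (8 * (n + 1)) =
      hankelCoeff n ν * (4 * ν ^ 2 - (2 * (n : ℂ) + 1) ^ 2) := by
  have h1 : ((n.factorial : ℕ) : ℂ) ≠ 0 := by exact_mod_cast n.factorial_ne_zero
  have h2 : (n : ℂ) + 1 ≠ 0 := by exact_mod_cast n.succ_ne_zero
  rw [hankelCoeff, hankelCoeff, Finset.prod_range_succ, Nat.factorial_succ]
  push_cast
  field_simp
  ring

theorem remainderConst_mul_bilateralLaplace_sechPow_zero {ν : ℂ} (hν : |ν.re| < 1 / 2) :
    remainderConst ν * bilateralLaplace (sechPow 0) ν = (Real.sqrt (2 / Real.pi) : ℂ) := by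
  have h := bilateralLaplace_sechPow (n := 0) (ν := ν) (by simpa using hν)
  obtain ⟨h1, h2⟩ := abs_lt.mp hν
  have hpi : (Real.pi : ℂ) ≠ 0 := by exact_mod_cast Real.pi_ne_zero
  have hsin : Complex.sin (Real.pi * (1 / 2 + ν)) = Complex.cos (Real.pi * ν) := by
    rw [mul_add, add_comm, mul_one_div, Complex.sin_add_pi_div_two]
  have hG := Complex.Gamma_mul_Gamma_one_sub (1 / 2 + ν)
  rw [show (1 - (1 / 2 + ν) : ℂ) = 1 / 2 - ν by ring, hsin] at hG
  have hcos : Complex.cos (Real.pi * ν) ≠ 0 := by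
    intro h0
    rw [h0, div_zero] at hG
    refine mul_ne_zero (Complex.Gamma_ne_zero_of_re_pos ?_)
      (Complex.Gamma_ne_zero_of_re_pos ?_) hG
    · rw [Complex.add_re]; norm_num; linarith
    · rw [Complex.sub_re]; norm_num; linarith
  simp only [Nat.cast_zero, zero_add, mul_zero, Nat.factorial_zero, Nat.cast_one, mul_one] at h
  rw [h, hG, remainderConst, two_div_pi_cpow]
  field_simp

theorem bilateralLaplace_sechPow_succ (n : ℕ) {ν : ℂ} (hν : |ν.re| < 1 / 2) :
    bilateralLaplace (sechPow (n + 1)) ν * ((2 * n + 1) * (2 * n + 2)) =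
      bilateralLaplace (sechPow n) ν * ((n + 1 / 2) ^ 2 - ν ^ 2) := by
  have hn : (0 : ℝ) ≤ n := n.cast_nonneg
  have h0 := bilateralLaplace_sechPow (n := n) (ν := ν) (by linarith)
  have h1 := bilateralLaplace_sechPow (n := n + 1) (ν := ν) (by push_cast; linarith)
  obtain ⟨h2, h3⟩ := abs_lt.mp hν
  have e1 : (n : ℂ) + 1 / 2 + ν ≠ 0 := fun h => by
    have := congrArg Complex.re h; norm_num at this; linarith
  have e2 : (n : ℂ) + 1 / 2 - ν ≠ 0 := fun h => by
    have := congrArg Complex.re h; norm_num at this; linarith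
  have h4 : (((2 * n).factorial : ℕ) : ℂ) ≠ 0 := by exact_mod_cast (2 * n).factorial_ne_zero
  rw [show (((n + 1 : ℕ) : ℂ) + 1 / 2 + ν) = (n + 1 / 2 + ν) + 1 by push_cast; ring,
    show (((n + 1 : ℕ) : ℂ) + 1 / 2 - ν) = (n + 1 / 2 - ν) + 1 by push_cast; ring,
    Complex.Gamma_add_one _ e1, Complex.Gamma_add_one _ e2,
    show 2 * (n + 1) = 2 * n + 1 + 1 by ring, Nat.factorial_succ, Nat.factorial_succ] at h1
  push_cast at h1
  refine mul_right_cancel₀ h4 ?_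
  linear_combination h1 - ((n + 1 / 2) ^ 2 - ν ^ 2 : ℂ) * h0

theorem bilateralLaplace_const_mul (c : ℝ) (φ : ℝ → ℝ) (ν : ℂ) :
    bilateralLaplace (fun u => c * φ u) ν = c * bilateralLaplace φ ν := by
  unfold bilateralLaplace
  rw [← integral_const_mul]
  refine integral_congr_ae (ae_of_all _ fun u => ?_)
  push_cast
  ring

/-- The moments of `t^{-1/2} e^{-t} K_ν(t)` are the coefficients `a_n(ν)`. -/
theorem remainderConst_mul_moment (n : ℕ) {ν : ℂ} (hν : |ν.re| < 1 / 2) :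
    remainderConst ν * ∫ t in Ioi (0 : ℝ), (besselWeight n t : ℂ) * macdonaldIntegral ν t =
      (-1) ^ n * hankelCoeff n ν := by
  have hn : (0 : ℝ) ≤ n := n.cast_nonneg
  have h := integral_besselWeight_mul_macdonaldIntegral (N := n) (ν := ν) (by linarith)
    (k := fun _ => 1) measurable_const (by simp)
  simp only [mul_one] at h
  rw [h, show weightKernel n (fun _ => 1) = fun u => _ from funext (weightKernel_one n),
    bilateralLaplace_const_mul]
  clear h hn
  induction n with
  | zero =>
    have h0 := remainderConst_mul_bilateralLaplace_sechPow_zero hν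
    have h1 : Real.Gamma ((0 : ℕ) + 1 / 2) * 2 ^ (((0 : ℕ) : ℝ) + 1 / 2) * √(2 / Real.pi) = 2 := by
      rw [Nat.cast_zero, zero_add, Real.Gamma_one_half_eq, ← Real.sqrt_eq_rpow,
        ← Real.sqrt_mul Real.pi_pos.le, ← Real.sqrt_mul (by positivity),
        show Real.pi * 2 * (2 / Real.pi) = 2 * 2 by field_simp, Real.sqrt_mul_self two_pos.le]
    have h1' : ((Real.Gamma ((0 : ℕ) + 1 / 2) * 2 ^ (((0 : ℕ) : ℝ) + 1 / 2) : ℝ) : ℂ)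
        * (√(2 / Real.pi) : ℂ) = 2 := by exact_mod_cast congrArg Complex.ofReal h1
    have h2 : hankelCoeff 0 ν = 1 := by simp [hankelCoeff]
    rw [h2]
    linear_combination (1 / 2 : ℂ) * h1' + (1 / 2 : ℂ) *
      ((Real.Gamma ((0 : ℕ) + 1 / 2) * 2 ^ (((0 : ℕ) : ℝ) + 1 / 2) : ℝ) : ℂ) * h0
  | succ n ih =>
    have h1 := bilateralLaplace_sechPow_succ n hν
    have h2 := hankelCoeff_succ n ν
    have h3 : Real.Gamma ((n + 1 : ℕ) + 1 / 2) * 2 ^ (((n + 1 : ℕ) : ℝ) + 1 / 2) =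
        (2 * n + 1) * (Real.Gamma (n + 1 / 2) * 2 ^ ((n : ℝ) + 1 / 2)) := by
      rw [show (((n + 1 : ℕ) : ℝ) + 1 / 2) = ((n : ℝ) + 1 / 2) + 1 by push_cast; ring,
        Real.Gamma_add_one (by positivity), Real.rpow_add_one two_ne_zero]
      ring
    rw [h3]
    have e2 : ((n : ℂ) + 1) ≠ 0 := by exact_mod_cast n.succ_ne_zero
    have e3 : (8 * ((n : ℂ) + 1)) ≠ 0 := mul_ne_zero (by norm_num) e2
    refine mul_right_cancel₀ e3 ?_
    push_cast at ih ⊢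
    linear_combination (-1 : ℂ) ^ (n + 1) * (-1) * h2
      + remainderConst ν * 2 * ((Real.Gamma (n + 1 / 2) : ℂ) * (2 ^ ((n : ℝ) + 1 / 2) : ℝ)) * h1
      - (4 * ν ^ 2 - (2 * (n : ℂ) + 1) ^ 2) * ih

/-- An integral over the line, folded onto the positive half-line. -/
theorem integral_eq_integral_Ioi_add_neg {E : Type*} [NormedAddCommGroup E] [NormedSpace ℝ E]
    {g : ℝ → E} (hg : Integrable g) : ∫ v, g v = ∫ v in Ioi (0 : ℝ), (g v + g (-v)) := by
  have hneg := integral_comp_neg_Ioi (0 : ℝ) g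
  rw [neg_zero] at hneg
  rw [integral_add hg.integrableOn hg.comp_neg.integrableOn, hneg, add_comm,
    intervalIntegral.integral_Iic_add_Ioi hg.integrableOn hg.integrableOn]

theorem strictMonoOn_sinh_half_div_sq {x c : ℝ} (hx : 0 < x) (hc : 0 < c) :
    StrictMonoOn (fun v => x * (Real.sinh (v / 2) / c) ^ 2) (Ioi 0) := by
  intro v hv w _ hvw
  have h1 : 0 < Real.sinh (v / 2) := Real.sinh_pos_iff.mpr (half_pos hv)
  have h2 : Real.sinh (v / 2) < Real.sinh (w / 2) := Real.sinh_lt_sinh.mpr (by linarith)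
  simp only
  gcongr

theorem image_sinh_half_div_sq {x c : ℝ} (hx : 0 < x) (hc : 0 < c) :
    (fun v => x * (Real.sinh (v / 2) / c) ^ 2) '' Ioi 0 = Ioi 0 := by
  ext t
  constructor
  · rintro ⟨v, hv, rfl⟩
    have h1 : 0 < Real.sinh (v / 2) := Real.sinh_pos_iff.mpr (half_pos hv)
    exact mem_Ioi.mpr (by positivity)
  · intro ht
    have ht' : 0 < t := ht
    refine ⟨2 * Real.arsinh (c * √(t / x)), ?_, ?_⟩
    · have : 0 < Real.arsinh (c * √(t / x)) := Real.arsinh_pos_iff.mpr (by positivity)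
      exact mem_Ioi.mpr (by positivity)
    · simp only
      rw [mul_div_cancel_left₀ _ two_ne_zero, Real.sinh_arsinh, mul_div_cancel_left₀ _ hc.ne',
        Real.sq_sqrt (by positivity), mul_div_cancel₀ _ hx.ne']

/-- The substitution `t (1 + cosh u) = x (cosh v - 1)` turns the inner integral into a
convolution of `e^{-x cosh v}` with the hyperbolic secant. -/
theorem weightKernel_zero_stieltjes {x : ℝ} (hx : 0 < x) (u : ℝ) :
    weightKernel 0 (fun t => (1 + |t| / x)⁻¹) u =
      √x * Real.exp x * ∫ v, Real.exp (-(x * Real.cosh v)) * sechPow 0 (u - v) := by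
  have hint : Integrable fun v => Real.exp (-(x * Real.cosh v)) * sechPow 0 (u - v) := by
    have h0 := (expDecay_exp_neg_cosh hx 1).integrable_real (t := 0) (by simp)
    simp only [zero_mul, Real.exp_zero, one_mul] at h0
    have hm := (expDecay_sechPow 0).measurable
    refine h0.mono (by fun_prop : Measurable _).aestronglyMeasurable (ae_of_all _ fun v => ?_)
    rw [norm_mul, Real.norm_of_nonneg (sechPow_pos 0 _).le]
    refine mul_le_of_le_one_right (norm_nonneg _) (inv_le_one_of_one_le₀ ?_)
    linarith [Real.one_le_cosh ((u - v) / 2)]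
  set c := Real.cosh (u / 2) with hc
  have hc0 : 0 < c := Real.cosh_pos _
  rw [integral_eq_integral_Ioi_add_neg hint, ← integral_const_mul, weightKernel]
  conv_lhs => rw [← image_sinh_half_div_sq hx hc0]
  have hd : ∀ v ∈ Ioi (0 : ℝ), HasDerivWithinAt (fun v => x * (Real.sinh (v / 2) / c) ^ 2)
      (x * (Real.sinh (v / 2) * Real.cosh (v / 2)) / c ^ 2) (Ioi 0) v := by
    intro v _
    have h1 : HasDerivAt (fun v : ℝ => Real.sinh (v / 2)) (Real.cosh (v / 2) * (1 / 2)) v :=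
      ((hasDerivAt_id v).div_const 2).sinh
    refine ((((h1.div_const c).pow 2).const_mul x).congr_deriv ?_).hasDerivWithinAt
    norm_num
    field_simp
  rw [integral_image_eq_integral_abs_deriv_smul measurableSet_Ioi hd
    (strictMonoOn_sinh_half_div_sq hx hc0).injOn]
  refine setIntegral_congr_fun measurableSet_Ioi fun v hv => ?_
  have hs : 0 < Real.sinh (v / 2) := Real.sinh_pos_iff.mpr (half_pos hv)
  have hd : 0 < Real.cosh (v / 2) := Real.cosh_pos _
  set s := Real.sinh (v / 2)
  set d := Real.cosh (v / 2)
  have hw : besselWeight 0 (x * (s / c) ^ 2) = c / (√x * s) * Real.exp (-(x * (s / c) ^ 2)) := by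
    rw [besselWeight, Nat.cast_zero, zero_sub, Real.rpow_neg (by positivity),
      ← Real.sqrt_eq_rpow, Real.sqrt_mul hx.le, Real.sqrt_sq (by positivity)]
    congr 1
    field_simp
  have hcu : Real.cosh u = 2 * c ^ 2 - 1 := by
    have := Real.cosh_two_mul (u / 2)
    rw [mul_div_cancel₀ u two_ne_zero] at this
    rw [this, Real.sinh_sq, hc]; ring
  have hcv : Real.cosh v = 2 * s ^ 2 + 1 := by
    have := Real.cosh_two_mul (v / 2)
    rw [mul_div_cancel₀ v two_ne_zero] at this
    rw [this, Real.cosh_sq]; ring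
  have hexp : Real.exp (-(x * (s / c) ^ 2)) * Real.exp (-(x * (s / c) ^ 2 * Real.cosh u)) =
      Real.exp x * Real.exp (-(x * Real.cosh v)) := by
    rw [← Real.exp_add, ← Real.exp_add, hcu, hcv]
    congr 1
    field_simp
    ring
  have hp : 0 < Real.cosh ((u + v) / 2) := Real.cosh_pos _
  have hm : 0 < Real.cosh ((u - v) / 2) := Real.cosh_pos _
  have hadd : Real.cosh ((u + v) / 2) = c * d + Real.sinh (u / 2) * s := by
    rw [add_div, Real.cosh_add]
  have hsub : Real.cosh ((u - v) / 2) = c * d - Real.sinh (u / 2) * s := by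
    rw [sub_div, Real.cosh_sub]
  have hprod : Real.cosh ((u + v) / 2) * Real.cosh ((u - v) / 2) = c ^ 2 + s ^ 2 := by
    have h1 : d ^ 2 = s ^ 2 + 1 := Real.cosh_sq _
    have h2 : c ^ 2 = Real.sinh (u / 2) ^ 2 + 1 := Real.cosh_sq _
    rw [hadd, hsub]
    linear_combination c ^ 2 * h1 + s ^ 2 * h2
  have hsech : sechPow 0 (u - v) + sechPow 0 (u + v) = c * d / (c ^ 2 + s ^ 2) := by
    have : c * d = (Real.cosh ((u + v) / 2) + Real.cosh ((u - v) / 2)) / 2 := by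
      rw [hadd, hsub]; ring
    rw [← hprod, this]
    simp only [sechPow, mul_zero, zero_add, pow_one]
    field_simp
  have hk : (1 + |x * (s / c) ^ 2| / x)⁻¹ = c ^ 2 / (c ^ 2 + s ^ 2) := by
    rw [abs_of_pos (by positivity)]
    field_simp
  simp only [smul_eq_mul]
  rw [hw, hk, Real.cosh_neg, sub_neg_eq_add, ← mul_add, hsech, abs_of_pos (by positivity)]
  have hsq : √x * √x = x := Real.mul_self_sqrt hx.le
  have hsx : 0 < √x := Real.sqrt_pos.mpr hx
  calc x * (s * d) / c ^ 2 * (c / (√x * s) * Real.exp (-(x * (s / c) ^ 2)) *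
        Real.exp (-(x * (s / c) ^ 2 * Real.cosh u)) * (c ^ 2 / (c ^ 2 + s ^ 2)))
      = x * (s * d) / c ^ 2 * (c / (√x * s)) * (c ^ 2 / (c ^ 2 + s ^ 2)) *
        (Real.exp (-(x * (s / c) ^ 2)) * Real.exp (-(x * (s / c) ^ 2 * Real.cosh u))) := by ring
    _ = √x * (c * d / (c ^ 2 + s ^ 2)) * (Real.exp x * Real.exp (-(x * Real.cosh v))) := by
        rw [hexp]
        congr 1
        nth_rewrite 1 [← hsq]
        field_simp
    _ = _ := by ring

/-- The Laplace transform of the convolution is the product of those of its factors, of which the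
first is `2 K_ν(x)`. -/
theorem bilateralLaplace_weightKernel_zero {ν : ℂ} (hν : |ν.re| < 1 / 2) {x : ℝ} (hx : 0 < x) :
    bilateralLaplace (weightKernel 0 (fun t => (1 + |t| / x)⁻¹)) ν =
      √x * Real.exp x * (2 * macdonaldIntegral ν x * bilateralLaplace (sechPow 0) ν) := by
  have h1 := (expDecay_exp_neg_cosh hx (|ν.re| + 1)).integrable (ν := ν) (lt_add_one _)
  have h2 := (expDecay_sechPow 0).integrable (ν := ν) (by simpa using hν)
  have h := integral_convolution (ContinuousLinearMap.mul ℂ ℂ) h1 h2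
  have h3 : 2 * macdonaldIntegral ν x =
      bilateralLaplace (fun u => Real.exp (-(x * Real.cosh u))) ν := by
    rw [macdonaldIntegral, ← mul_assoc, mul_one_div_cancel two_ne_zero, one_mul]
  rw [ContinuousLinearMap.mul_apply'] at h
  rw [h3]
  change _ = _ * ((∫ _, _) * (∫ _, _))
  rw [← h, ← integral_const_mul, bilateralLaplace]
  refine integral_congr_ae (ae_of_all _ fun u => ?_)
  simp only [convolution, ContinuousLinearMap.mul_apply']
  rw [weightKernel_zero_stieltjes hx, Complex.ofReal_mul, ← integral_complex_ofReal,
    mul_left_comm, Complex.ofReal_mul, ← integral_const_mul]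
  congr 1
  refine integral_congr_ae (ae_of_all _ fun v => ?_)
  simp only
  rw [mul_mul_mul_comm, ← Complex.exp_add]
  push_cast
  ring_nf

/-! ### The expansion of `K_ν` with its remainder -/

/-- A point off the negative real axis has a neighbourhood at positive distance from that axis. -/
theorem exists_pos_eventually_le_norm_add {z : ℂ} (hz : z ∈ Complex.slitPlane) :
    ∃ δ > 0, ∀ᶠ w : ℂ in 𝓝 z, ∀ t : ℝ, 0 ≤ t → δ ≤ ‖w + t‖ := by
  obtain ⟨r, hr, hball⟩ := Metric.isOpen_iff.mp Complex.isOpen_slitPlane z hz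
  refine ⟨r / 2, half_pos hr, ?_⟩
  filter_upwards [Metric.ball_mem_nhds z (half_pos hr)] with w hw t ht
  by_contra! hlt
  have hmem : (-t : ℂ) ∈ Metric.ball z r := by
    rw [Metric.mem_ball, dist_comm]
    calc dist z (-t : ℂ) ≤ dist z w + dist w (-t : ℂ) := dist_triangle _ _ _
      _ < r / 2 + r / 2 := by
          refine add_lt_add (by rwa [dist_comm]) ?_
          rwa [dist_eq_norm, sub_neg_eq_add]
      _ = r := add_halves r
  have := hball hmem
  rw [Complex.mem_slitPlane_iff] at this
  simp at this
  linarith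

theorem exists_bound_inv_one_add_div {z : ℂ} (hz : z ∈ Complex.slitPlane) :
    ∃ C, ∀ t : ℝ, 0 ≤ t → ‖(1 + t / z)⁻¹‖ ≤ C := by
  obtain ⟨δ, hδ, h⟩ := exists_pos_eventually_le_norm_add hz
  have hz0 := Complex.slitPlane_ne_zero hz
  refine ⟨‖z‖ / δ, fun t ht => ?_⟩
  have h1 := h.self_of_nhds t ht
  rw [one_add_div hz0, inv_div, norm_div]
  gcongr

/-- The Stieltjes-type integral `∫ t^{N-1/2} e^{-t} K_ν(t) / (1 + t/z) dt` over `t > 0`. -/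
noncomputable def stieltjesIntegral (N : ℕ) (ν z : ℂ) : ℂ :=
  ∫ t in Ioi (0 : ℝ), (besselWeight N t : ℂ) * macdonaldIntegral ν t * (1 + t / z)⁻¹

theorem integrableOn_stieltjesIntegral {N : ℕ} {ν z : ℂ} (hν : |ν.re| < (N : ℝ) + 1 / 2)
    (hz : z ∈ Complex.slitPlane) :
    IntegrableOn (fun t : ℝ => (besselWeight N t : ℂ) * macdonaldIntegral ν t * (1 + t / z)⁻¹)
      (Ioi 0) := by
  obtain ⟨C, hC⟩ := exists_bound_inv_one_add_div hz
  refine (integrableOn_besselWeight_mul_macdonaldIntegral hν).mul_bdd (c := C)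
    (by fun_prop : Measurable _).aestronglyMeasurable ?_
  filter_upwards [ae_restrict_mem measurableSet_Ioi] with t ht
  exact hC t (mem_Ioi.mp ht).le

theorem stieltjesIntegral_eq_sub {N : ℕ} {ν z : ℂ} (hν : |ν.re| < (N : ℝ) + 1 / 2)
    (hz : z ∈ Complex.slitPlane) :
    stieltjesIntegral N ν z =
      (∫ t in Ioi (0 : ℝ), (besselWeight N t : ℂ) * macdonaldIntegral ν t)
        - 1 / z * stieltjesIntegral (N + 1) ν z := by
  have hν' : |ν.re| < ((N + 1 : ℕ) : ℝ) + 1 / 2 := by push_cast; linarith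
  have hz0 := Complex.slitPlane_ne_zero hz
  obtain ⟨δ, hδ, h⟩ := exists_pos_eventually_le_norm_add hz
  unfold stieltjesIntegral
  rw [← integral_const_mul, ← integral_sub (integrableOn_besselWeight_mul_macdonaldIntegral hν)
    ((integrableOn_stieltjesIntegral hν' hz).const_mul _)]
  refine setIntegral_congr_fun measurableSet_Ioi fun t ht => ?_
  have hzt : z + t ≠ 0 := norm_pos_iff.mp (hδ.trans_le (h.self_of_nhds t (mem_Ioi.mp ht).le))
  rw [besselWeight_succ N (mem_Ioi.mp ht), one_add_div hz0, inv_div]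
  push_cast
  field_simp
  ring

/-- Expanding the kernel `1 / (1 + t/z)` in a finite geometric series. -/
theorem sum_add_stieltjesIntegral (N : ℕ) {ν z : ℂ} (hν : |ν.re| < 1 / 2)
    (hz : z ∈ Complex.slitPlane) :
    ∑ n ∈ Finset.range N, hankelCoeff n ν / z ^ n
      + (-1) ^ N / z ^ N * (remainderConst ν * stieltjesIntegral N ν z) =
    remainderConst ν * stieltjesIntegral 0 ν z := by
  have hz0 := Complex.slitPlane_ne_zero hz
  induction N with
  | zero => simp
  | succ N ih =>
    have hN : (0 : ℝ) ≤ N := N.cast_nonneg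
    have h1 := stieltjesIntegral_eq_sub (N := N) (ν := ν) (by linarith) hz
    have h2 := remainderConst_mul_moment N hν
    have h3 : ((-1 : ℂ) ^ N) * (-1) ^ N = 1 := by rw [← mul_pow]; simp
    rw [← ih, Finset.sum_range_succ, h1, mul_sub, h2]
    rw [pow_succ, pow_succ]
    field_simp
    linear_combination (-hankelCoeff N ν * z) * h3

theorem stieltjesIntegral_ofReal {N : ℕ} {ν : ℂ} (hν : |ν.re| < (N : ℝ) + 1 / 2) {x : ℝ}
    (hx : 0 < x) : stieltjesIntegral N ν x =
      1 / 2 * bilateralLaplace (weightKernel N (fun t => (1 + |t| / x)⁻¹)) ν := by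
  rw [← integral_besselWeight_mul_macdonaldIntegral hν (by fun_prop), stieltjesIntegral]
  · refine setIntegral_congr_fun measurableSet_Ioi fun t ht => ?_
    rw [abs_of_pos (mem_Ioi.mp ht)]
    push_cast
    ring
  · intro t
    have : 0 ≤ |t| / x := by positivity
    rw [abs_of_pos (by positivity)]
    exact inv_le_one_of_one_le₀ (by linarith)

theorem differentiable_hankelCoeff (n : ℕ) : Differentiable ℂ (hankelCoeff n) := by
  unfold hankelCoeff
  fun_prop

theorem differentiable_remainderConst : Differentiable ℂ remainderConst := by
  unfold remainderConst
  fun_prop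

/-- The expansion for positive real argument. It is first obtained for `|Re ν| < 1/2`, and then
extended to the strip by analyticity in `ν`. -/
theorem macdonaldIntegral_expansion {N : ℕ} {ν : ℂ} (hν : |ν.re| < (N : ℝ) + 1 / 2) {x : ℝ}
    (hx : 0 < x) :
    (√(2 / Real.pi) : ℂ) * (√x * Real.exp x) * macdonaldIntegral ν x =
      ∑ n ∈ Finset.range N, hankelCoeff n ν / (x : ℂ) ^ n
        + (-1) ^ N / (x : ℂ) ^ N * (remainderConst ν * stieltjesIntegral N ν x) := by
  have hk1 : ∀ t : ℝ, |(1 + |t| / x)⁻¹| ≤ 1 := fun t => by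
    have : 0 ≤ |t| / x := by positivity
    rw [abs_of_pos (by positivity)]
    exact inv_le_one_of_one_le₀ (by linarith)
  have hdec := expDecay_weightKernel N (k := fun t => (1 + |t| / x)⁻¹) (by fun_prop)
    (fun t _ => by positivity) hk1
  set S : Set ℂ := {ν | |ν.re| < (N : ℝ) + 1 / 2} with hS
  set f : ℂ → ℂ := fun ν => (√(2 / Real.pi) : ℂ) * (√x * Real.exp x) * macdonaldIntegral ν x
  set g : ℂ → ℂ := fun ν => ∑ n ∈ Finset.range N, hankelCoeff n ν / (x : ℂ) ^ n
        + (-1) ^ N / (x : ℂ) ^ N * (remainderConst ν *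
          (1 / 2 * bilateralLaplace (weightKernel N (fun t => (1 + |t| / x)⁻¹)) ν)) with hg
  have hf : AnalyticOnNhd ℂ f S := fun ν _ =>
    ((differentiable_macdonaldIntegral hx).const_mul _).analyticAt ν
  have hga : AnalyticOnNhd ℂ g S := by
    have h1 : Differentiable ℂ fun ν => ∑ n ∈ Finset.range N, hankelCoeff n ν / (x : ℂ) ^ n :=
      Differentiable.fun_sum fun n _ => (differentiable_hankelCoeff n).div_const _
    intro ν hν
    exact (h1.analyticAt ν).add (analyticAt_const.mul
      ((differentiable_remainderConst.analyticAt ν).mul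
        (analyticAt_const.mul (hdec.analyticOnNhd ν hν))))
  have hconn : IsPreconnected S := by
    have : S = Complex.reLm ⁻¹' (Ioo (-((N : ℝ) + 1 / 2)) ((N : ℝ) + 1 / 2)) := by
      ext ν; simp only [hS, mem_ofPred_eq, abs_lt]; rfl
    rw [this]
    exact ((convex_Ioo _ _).linear_preimage Complex.reLm).isPreconnected
  have hnear : f =ᶠ[𝓝 0] g := by
    have hopen : IsOpen {ν : ℂ | |ν.re| < 1 / 2} := isOpen_lt (by fun_prop) continuous_const
    filter_upwards [hopen.mem_nhds (by simp : (0 : ℂ) ∈ _)] with ν hν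
    have hN : (0 : ℝ) ≤ N := N.cast_nonneg
    have hν' : |ν.re| < 1 / 2 := hν
    have hxs : (x : ℂ) ∈ Complex.slitPlane := Complex.ofReal_mem_slitPlane.mpr hx
    have e1 := sum_add_stieltjesIntegral N hν' hxs
    have e2 := remainderConst_mul_bilateralLaplace_sechPow_zero hν'
    rw [stieltjesIntegral_ofReal (N := N) (by linarith) hx,
      stieltjesIntegral_ofReal (N := 0) (by simpa using hν') hx,
      bilateralLaplace_weightKernel_zero hν' hx] at e1
    change f ν = _
    rw [hg]
    simp only
    rw [e1]
    simp only [f]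
    rw [← e2]
    ring
  have h0 : (0 : ℂ) ∈ S := by
    simp only [hS, mem_ofPred_eq, Complex.zero_re, abs_zero]; positivity
  have := hf.eqOn_of_preconnected_of_eventuallyEq hga hconn h0 hnear hν
  rw [stieltjesIntegral_ofReal hν hx]
  exact this

theorem differentiableAt_integral_inv_add {N : ℕ} {ν z : ℂ} (hν : |ν.re| < (N : ℝ) + 1 / 2)
    (hz : z ∈ Complex.slitPlane) :
    DifferentiableAt ℂ (fun z : ℂ => ∫ t in Ioi (0 : ℝ),
      (besselWeight N t : ℂ) * macdonaldIntegral ν t * (z + t)⁻¹) z := by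
  obtain ⟨δ, hδ, h⟩ := exists_pos_eventually_le_norm_add hz
  have hi := integrableOn_besselWeight_mul_macdonaldIntegral hν
  have hm : ∀ f : ℝ → ℂ, Measurable f → AEStronglyMeasurable (fun t : ℝ =>
      (besselWeight N t : ℂ) * macdonaldIntegral ν t * f t) (volume.restrict (Ioi 0)) := fun f hf =>
    hi.aestronglyMeasurable.mul hf.aestronglyMeasurable
  refine (hasDerivAt_integral_of_dominated_loc_of_deriv_le (𝕜 := ℂ)
    (F := fun (z : ℂ) (t : ℝ) => (besselWeight N t : ℂ) * macdonaldIntegral ν t * (z + t)⁻¹)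
    (F' := fun (z : ℂ) (t : ℝ) => (besselWeight N t : ℂ) * macdonaldIntegral ν t * (-1 / (z + t) ^ 2))
    (bound := fun t => ‖(besselWeight N t : ℂ) * macdonaldIntegral ν t‖ * (1 / δ ^ 2))
    h (Eventually.of_forall fun w => hm _ (by fun_prop)) ?_ (hm _ (by fun_prop)) ?_
    (hi.norm.mul_const _) ?_).2.differentiableAt
  · refine hi.mul_bdd (c := δ⁻¹) (by fun_prop : Measurable _).aestronglyMeasurable ?_
    filter_upwards [ae_restrict_mem measurableSet_Ioi] with t ht
    rw [norm_inv]
    exact inv_anti₀ hδ (h.self_of_nhds t (mem_Ioi.mp ht).le)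
  · filter_upwards [ae_restrict_mem measurableSet_Ioi] with t ht w hw
    rw [norm_mul, norm_div, norm_neg, norm_one, norm_pow]
    have := hw t (mem_Ioi.mp ht).le
    gcongr
  · filter_upwards [ae_restrict_mem measurableSet_Ioi] with t ht w hw
    have hwt : w + t ≠ 0 := norm_pos_iff.mp (hδ.trans_le (hw t (mem_Ioi.mp ht).le))
    exact (((hasDerivAt_id w).add_const (t : ℂ)).inv hwt).const_mul _

theorem differentiableOn_stieltjesIntegral {N : ℕ} {ν : ℂ} (hν : |ν.re| < (N : ℝ) + 1 / 2) :
    DifferentiableOn ℂ (stieltjesIntegral N ν) Complex.slitPlane := by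
  have h : DifferentiableOn ℂ (fun z : ℂ => z * ∫ t in Ioi (0 : ℝ),
      (besselWeight N t : ℂ) * macdonaldIntegral ν t * (z + t)⁻¹) Complex.slitPlane :=
    fun z hz => (differentiableAt_id.mul (differentiableAt_integral_inv_add hν hz)).differentiableWithinAt
  refine h.congr fun z hz => ?_
  have hz0 := Complex.slitPlane_ne_zero hz
  rw [stieltjesIntegral, ← integral_const_mul]
  refine integral_congr_ae (ae_of_all _ fun t => ?_)
  simp only
  rw [one_add_div hz0, inv_div]
  ring

theorem div_two_mem_slitPlane {z : ℂ} (hz : z ∈ Complex.slitPlane) : z / 2 ∈ Complex.slitPlane := by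
  rw [Complex.mem_slitPlane_iff] at *
  simpa using hz

theorem differentiableOn_besselI (ν : ℂ) : DifferentiableOn ℂ (besselI ν) Complex.slitPlane := by
  rw [show besselI ν = fun z => _ from funext (besselI_eq ν)]
  intro z hz
  have h1 : DifferentiableAt ℂ (fun z : ℂ => (z / 2) ^ ν) z :=
    (differentiableAt_id.div_const 2).cpow_const (div_two_mem_slitPlane hz)
  have h2 : DifferentiableAt ℂ (besselSeries ν ∘ fun z : ℂ => z ^ 2 / 4) z :=
    (hasDerivAt_besselSeries ν (z ^ 2 / 4)).differentiableAt.comp z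
      (by fun_prop : DifferentiableAt ℂ (fun z : ℂ => z ^ 2 / 4) z)
  exact (h1.mul h2).differentiableWithinAt

/-- The factor `(π/2)^{1/2} z^{-1/2} e^{-z}` split off in the expansion of `K_ν(z)`. -/
noncomputable def macdonaldFactor (z : ℂ) : ℂ :=
  ((Real.pi : ℂ) / 2) ^ (1 / 2 : ℂ) / z ^ (1 / 2 : ℂ) * Complex.exp (-z)

theorem macdonaldFactor_ne_zero {z : ℂ} (hz : z ≠ 0) : macdonaldFactor z ≠ 0 := by
  have hpi : (Real.pi : ℂ) / 2 ≠ 0 := by exact_mod_cast (half_pos Real.pi_pos).ne'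
  have h1 : ((Real.pi : ℂ) / 2) ^ (1 / 2 : ℂ) ≠ 0 := by simp [Complex.cpow_eq_zero_iff, hpi]
  have h2 : z ^ (1 / 2 : ℂ) ≠ 0 := by simp [Complex.cpow_eq_zero_iff, hz]
  exact mul_ne_zero (div_ne_zero h1 h2) (Complex.exp_ne_zero _)

theorem differentiableOn_macdonaldFactor : DifferentiableOn ℂ macdonaldFactor Complex.slitPlane := by
  intro z hz
  have h2 : z ^ (1 / 2 : ℂ) ≠ 0 := by
    simp [Complex.cpow_eq_zero_iff, Complex.slitPlane_ne_zero hz]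
  have h1 : DifferentiableAt ℂ (fun z : ℂ => z ^ (1 / 2 : ℂ)) z :=
    differentiableAt_id.cpow_const hz
  exact (((differentiableAt_const _).div h1 h2).mul
    (by fun_prop : DifferentiableAt ℂ (fun z : ℂ => Complex.exp (-z)) z)).differentiableWithinAt

theorem macdonaldFactor_ofReal {x : ℝ} (hx : 0 < x) :
    macdonaldFactor x * ((√(2 / Real.pi) : ℂ) * (√x * Real.exp x)) = 1 := by
  have h1 : ∀ y : ℝ, 0 ≤ y → (y : ℂ) ^ (1 / 2 : ℂ) = (√y : ℂ) := fun y hy => by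
    rw [Real.sqrt_eq_rpow, Complex.ofReal_cpow hy]; push_cast; rfl
  have h2 : √(Real.pi / 2) * √(2 / Real.pi) = 1 := by
    rw [← Real.sqrt_mul (by positivity), div_mul_div_cancel₀ two_ne_zero, div_self Real.pi_ne_zero,
      Real.sqrt_one]
  have h3 : √x ≠ 0 := (Real.sqrt_pos.mpr hx).ne'
  have h4 : Real.exp (-x) * Real.exp x = 1 := by rw [← Real.exp_add]; simp
  rw [macdonaldFactor, show (Real.pi : ℂ) / 2 = ((Real.pi / 2 : ℝ) : ℂ) by push_cast; rfl,
    h1 _ (by positivity), h1 _ hx.le, ← Complex.ofReal_neg, ← Complex.ofReal_exp]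
  norm_cast
  calc _ = (√(Real.pi / 2) * √(2 / Real.pi)) * (√x / √x) * (Real.exp (-x) * Real.exp x) := by ring
    _ = 1 := by rw [h2, h4, div_self h3]; norm_num

/-- Both sides are analytic in the cut plane and agree on the positive axis. -/
theorem besselK_eq_of_not_int {N : ℕ} {ν z : ℂ} (hν : |ν.re| < (N : ℝ) + 1 / 2)
    (hint : ¬∃ n : ℤ, ν = n) (hz : z ∈ Complex.slitPlane) :
    besselK ν z = macdonaldFactor z * (∑ n ∈ Finset.range N, hankelCoeff n ν / z ^ n
        + (-1) ^ N / z ^ N * (remainderConst ν * stieltjesIntegral N ν z)) := by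
  set g : ℂ → ℂ := fun z => macdonaldFactor z * (∑ n ∈ Finset.range N, hankelCoeff n ν / z ^ n
        + (-1) ^ N / z ^ N * (remainderConst ν * stieltjesIntegral N ν z)) with hg
  have hfa : AnalyticOnNhd ℂ (besselK ν) Complex.slitPlane := by
    refine DifferentiableOn.analyticOnNhd ?_ Complex.isOpen_slitPlane
    rw [show besselK ν = fun z => _ from funext (besselK_of_not_int hint)]
    exact (((differentiableOn_besselI (-ν)).sub (differentiableOn_besselI ν)).const_mul
      _).div_const _
  have hga : AnalyticOnNhd ℂ g Complex.slitPlane := by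
    refine DifferentiableOn.analyticOnNhd ?_ Complex.isOpen_slitPlane
    have hpow : ∀ (n : ℕ) (c : ℂ), DifferentiableOn ℂ (fun z : ℂ => c / z ^ n) Complex.slitPlane :=
      fun n c z hz => ((differentiableAt_const c).div (differentiableAt_pow n)
        (pow_ne_zero n (Complex.slitPlane_ne_zero hz))).differentiableWithinAt
    exact differentiableOn_macdonaldFactor.mul
      ((DifferentiableOn.fun_sum fun n _ => hpow n _).add
        ((hpow N _).mul ((differentiableOn_stieltjesIntegral hν).const_mul _)))
  have h1 : (1 : ℂ) ∈ Complex.slitPlane := Complex.one_mem_slitPlane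
  have hconn : IsPreconnected Complex.slitPlane :=
    (Complex.starConvex_one_slitPlane.isPathConnected h1).isConnected.isPreconnected
  refine hfa.eqOn_of_preconnected_of_frequently_eq hga hconn h1 ?_ hz
  have htend : Tendsto (fun x : ℝ => (x : ℂ)) (𝓝[≠] 1) (𝓝[≠] 1) := by
    refine tendsto_nhdsWithin_iff.mpr ⟨?_, ?_⟩
    · simpa using (Complex.continuous_ofReal.tendsto 1).mono_left nhdsWithin_le_nhds
    · filter_upwards [self_mem_nhdsWithin] with x hx
      simpa using hx
  refine htend.frequently (Eventually.frequently ?_)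
  filter_upwards [mem_nhdsWithin_of_mem_nhds (Ioi_mem_nhds (zero_lt_one (α := ℝ)))] with x hx
  have e1 := macdonaldIntegral_expansion hν (mem_Ioi.mp hx)
  rw [hg, besselK_ofReal ν (mem_Ioi.mp hx)]
  simp only
  rw [← e1, ← mul_assoc, macdonaldFactor_ofReal (mem_Ioi.mp hx), one_mul]

/-- A bound that is uniform in the strip `|Re μ| ≤ σ`. -/
theorem norm_macdonaldIntegral_le {μ : ℂ} {σ t : ℝ} (hμ : |μ.re| ≤ σ) (ht : 0 < t) :
    ‖macdonaldIntegral μ t‖ ≤ ‖macdonaldIntegral σ t‖ + ‖macdonaldIntegral (-σ : ℝ) t‖ := by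
  have hi : ∀ s : ℝ, Integrable fun u : ℝ => Real.exp (s * u) * Real.exp (-(t * Real.cosh u)) :=
    fun s => (expDecay_exp_neg_cosh ht (|s| + 1)).integrable_real (lt_add_one _)
  have hreal : ∀ s : ℝ, ‖macdonaldIntegral s t‖ =
      1 / 2 * ∫ u : ℝ, Real.exp (s * u) * Real.exp (-(t * Real.cosh u)) := fun s => by
    have : macdonaldIntegral s t =
        ((1 / 2 * ∫ u : ℝ, Real.exp (s * u) * Real.exp (-(t * Real.cosh u)) : ℝ) : ℂ) := by
      rw [macdonaldIntegral, bilateralLaplace, Complex.ofReal_mul, ← integral_complex_ofReal]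
      push_cast
      rfl
    rw [this, Complex.norm_real, Real.norm_of_nonneg]
    exact mul_nonneg (by norm_num) (integral_nonneg fun u => by positivity)
  rw [hreal, hreal, ← mul_add, ← integral_add (hi _) (hi _), macdonaldIntegral, norm_mul]
  have hhalf : ‖(1 / 2 : ℂ)‖ = 1 / 2 := by norm_num
  rw [hhalf]
  gcongr
  refine norm_integral_le_of_norm_le ((hi _).add (hi _)) (ae_of_all _ fun u => ?_)
  rw [norm_mul, norm_cexp_mul_ofReal, Complex.norm_real, Real.norm_of_nonneg (Real.exp_pos _).le,
    ← add_mul]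
  gcongr
  have hle : μ.re * u ≤ σ * |u| := (le_abs_self _).trans (by rw [abs_mul]; gcongr)
  rcases le_total 0 u with hu | hu
  · rw [abs_of_nonneg hu] at hle
    linarith [Real.exp_le_exp.mpr hle, Real.exp_pos (-σ * u)]
  · rw [abs_of_nonpos hu, mul_neg, ← neg_mul] at hle
    linarith [Real.exp_le_exp.mpr hle, Real.exp_pos (σ * u)]

theorem continuousAt_stieltjesIntegral_order {N : ℕ} {ν z : ℂ} (hν : |ν.re| < (N : ℝ) + 1 / 2)
    (hz : z ∈ Complex.slitPlane) : ContinuousAt (fun ν => stieltjesIntegral N ν z) ν := by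
  obtain ⟨σ, h1, h2⟩ := exists_between hν
  have hσ0 : 0 ≤ σ := (abs_nonneg _).trans h1.le
  have hopen : IsOpen {μ : ℂ | |μ.re| < σ} := isOpen_lt (by fun_prop) continuous_const
  have hnhds : {μ : ℂ | |μ.re| < σ} ∈ 𝓝 ν := hopen.mem_nhds h1
  have hσi : ∀ s : ℝ, |s| = σ → IntegrableOn (fun t : ℝ =>
      (besselWeight N t : ℂ) * macdonaldIntegral s t * (1 + t / z)⁻¹) (Ioi 0) := fun s hs =>
    integrableOn_stieltjesIntegral (by rw [Complex.ofReal_re, hs]; exact h2) hz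
  refine continuousAt_of_dominated ?_ ?_
    ((hσi σ (abs_of_nonneg hσ0)).norm.add (hσi (-σ) (by rw [abs_neg, abs_of_nonneg hσ0])).norm) ?_
  · filter_upwards [hnhds] with μ hμ
    exact (integrableOn_stieltjesIntegral (lt_trans hμ h2) hz).aestronglyMeasurable
  · filter_upwards [hnhds] with μ hμ
    filter_upwards [ae_restrict_mem measurableSet_Ioi] with t ht
    have := norm_macdonaldIntegral_le (le_of_lt hμ) (mem_Ioi.mp ht)
    simp only [norm_mul, Pi.add_apply]
    rw [← add_mul, ← mul_add]
    gcongr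
  · filter_upwards [ae_restrict_mem measurableSet_Ioi] with t ht
    exact (continuousAt_const.mul
      (differentiable_macdonaldIntegral (mem_Ioi.mp ht)).continuous.continuousAt).mul
        continuousAt_const

theorem continuousAt_expansion {N : ℕ} {ν z : ℂ} (hν : |ν.re| < (N : ℝ) + 1 / 2)
    (hz : z ∈ Complex.slitPlane) :
    ContinuousAt (fun ν => macdonaldFactor z * (∑ n ∈ Finset.range N, hankelCoeff n ν / z ^ n
        + (-1) ^ N / z ^ N * (remainderConst ν * stieltjesIntegral N ν z))) ν := by
  have h1 : Continuous fun ν => ∑ n ∈ Finset.range N, hankelCoeff n ν / z ^ n :=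
    continuous_finsetSum _ fun n _ => (differentiable_hankelCoeff n).continuous.div_const _
  exact continuousAt_const.mul (h1.continuousAt.add (continuousAt_const.mul
    (differentiable_remainderConst.continuous.continuousAt.mul
      (continuousAt_stieltjesIntegral_order hν hz))))

/-- The expansion of `K_ν(z)` with its remainder, for all orders. -/
theorem besselK_eq {N : ℕ} {ν z : ℂ} (hν : |ν.re| < (N : ℝ) + 1 / 2)
    (hz : z ∈ Complex.slitPlane) :
    besselK ν z = macdonaldFactor z * (∑ n ∈ Finset.range N, hankelCoeff n ν / z ^ n
        + (-1) ^ N / z ^ N * (remainderConst ν * stieltjesIntegral N ν z)) := by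
  refine besselK_eq_of_continuousAt (continuousAt_expansion hν hz) ?_
  have hopen : IsOpen {μ : ℂ | |μ.re| < (N : ℝ) + 1 / 2} :=
    isOpen_lt (by fun_prop) continuous_const
  filter_upwards [hopen.mem_nhds hν] with μ hμ hint
  exact besselK_eq_of_not_int hμ hint hz

theorem continuous_besselK_order {z : ℂ} (hz : z ∈ Complex.slitPlane) :
    Continuous fun ν => besselK ν z := by
  rw [continuous_iff_continuousAt]
  intro ν
  obtain ⟨N, hN⟩ := exists_nat_gt |ν.re|
  have hopen : IsOpen {μ : ℂ | |μ.re| < (N : ℝ) + 1 / 2} :=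
    isOpen_lt (by fun_prop) continuous_const
  have hν : |ν.re| < (N : ℝ) + 1 / 2 := by linarith
  refine (continuousAt_expansion hν hz).congr ?_
  filter_upwards [hopen.mem_nhds hν] with μ hμ
  exact (besselK_eq hμ hz).symm

theorem remainderK_eq {N : ℕ} {ν z : ℂ} (hν : |ν.re| < (N : ℝ) + 1 / 2)
    (hz : z ∈ Complex.slitPlane) :
    remainderK N z ν = (-1) ^ N / z ^ N * (remainderConst ν * stieltjesIntegral N ν z) := by
  rw [remainderK]
  change besselK ν z / macdonaldFactor z - _ = _
  rw [besselK_eq hν hz, mul_div_cancel_left₀ _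
    (macdonaldFactor_ne_zero (Complex.slitPlane_ne_zero hz)), add_sub_cancel_left]

/-! ### From `K_ν` to `J_ν` -/

theorem mul_I_mem_slitPlane {z : ℂ} (hz : 0 < z.re) : z * Complex.I ∈ Complex.slitPlane := by
  rw [Complex.mem_slitPlane_iff]; right; simpa using hz.ne'

theorem mul_neg_I_mem_slitPlane {z : ℂ} (hz : 0 < z.re) : z * -Complex.I ∈ Complex.slitPlane := by
  rw [Complex.mem_slitPlane_iff]; right; simpa using hz.ne'

theorem cpow_mul_I {w : ℂ} (hw : 0 < w.re) (μ : ℂ) :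
    (w * Complex.I) ^ μ = Complex.exp (Real.pi / 2 * μ * Complex.I) * w ^ μ := by
  have hw0 : w ≠ 0 := by rintro rfl; simp at hw
  obtain ⟨h1, h2⟩ := abs_lt.mp (Complex.abs_arg_lt_pi_div_two_iff.mpr (Or.inl hw))
  have hlog : Complex.log (w * Complex.I) = Complex.log w + Complex.log Complex.I := by
    refine Complex.log_mul hw0 Complex.I_ne_zero ?_
    rw [Complex.arg_I]
    constructor <;> linarith [Real.pi_pos]
  rw [Complex.cpow_def_of_ne_zero (mul_ne_zero hw0 Complex.I_ne_zero),
    Complex.cpow_def_of_ne_zero hw0, hlog, Complex.log_I, ← Complex.exp_add]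
  ring_nf

theorem cpow_mul_neg_I {w : ℂ} (hw : 0 < w.re) (μ : ℂ) :
    (w * -Complex.I) ^ μ = Complex.exp (-(Real.pi / 2 * μ * Complex.I)) * w ^ μ := by
  have hw0 : w ≠ 0 := by rintro rfl; simp at hw
  have hI : -Complex.I ≠ 0 := neg_ne_zero.mpr Complex.I_ne_zero
  obtain ⟨h1, h2⟩ := abs_lt.mp (Complex.abs_arg_lt_pi_div_two_iff.mpr (Or.inl hw))
  have hlog : Complex.log (w * -Complex.I) = Complex.log w + Complex.log (-Complex.I) := by
    refine Complex.log_mul hw0 hI ?_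
    rw [Complex.arg_neg_I]
    constructor <;> linarith [Real.pi_pos]
  rw [Complex.cpow_def_of_ne_zero (mul_ne_zero hw0 hI),
    Complex.cpow_def_of_ne_zero hw0, hlog, Complex.log_neg_I, ← Complex.exp_add]
  ring_nf

theorem besselI_mul_I {z : ℂ} (hz : 0 < z.re) (μ : ℂ) :
    besselI μ (z * Complex.I) = Complex.exp (Real.pi / 2 * μ * Complex.I) * besselJ μ z := by
  have hz2 : 0 < (z / 2).re := by simpa using hz
  rw [besselI_eq, besselJ_eq, mul_div_right_comm, cpow_mul_I hz2, mul_pow, Complex.I_sq, mul_assoc]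
  ring_nf

theorem besselI_mul_neg_I {z : ℂ} (hz : 0 < z.re) (μ : ℂ) :
    besselI μ (z * -Complex.I) = Complex.exp (-(Real.pi / 2 * μ * Complex.I)) * besselJ μ z := by
  have hz2 : 0 < (z / 2).re := by simpa using hz
  rw [besselI_eq, besselJ_eq, mul_div_right_comm, cpow_mul_neg_I hz2, mul_pow, neg_sq,
    Complex.I_sq, mul_assoc]
  ring_nf

/-- The connection formula `πi J_ν(z) = e^{-πiν/2} K_ν(-iz) - e^{πiν/2} K_ν(iz)`. -/
theorem besselJ_eq_besselK {z : ℂ} (hz : 0 < z.re) (ν : ℂ) :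
    besselJ ν z = Complex.I / Real.pi *
      (Complex.exp (Real.pi / 2 * ν * Complex.I) * besselK ν (z * Complex.I)
        - Complex.exp (-(Real.pi / 2 * ν * Complex.I)) * besselK ν (z * -Complex.I)) := by
  have hz0 : z ≠ 0 := by rintro rfl; simp at hz
  have hpi : (Real.pi : ℂ) ≠ 0 := by exact_mod_cast Real.pi_ne_zero
  -- At integer orders `K_μ` is a limit in the order, so the formula is proved elsewhere first.
  have hgeneric : ∀ μ : ℂ, (¬∃ n : ℤ, μ = n) → besselJ μ z = Complex.I / Real.pi *
      (Complex.exp (Real.pi / 2 * μ * Complex.I) * besselK μ (z * Complex.I)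
        - Complex.exp (-(Real.pi / 2 * μ * Complex.I)) * besselK μ (z * -Complex.I)) := by
    intro μ hμ
    have hs : Complex.sin (Real.pi * μ) ≠ 0 := sin_pi_mul_ne_zero fun ⟨n, hn⟩ => hμ ⟨n, hn.symm⟩
    rw [besselK_of_not_int hμ, besselK_of_not_int hμ, besselI_mul_I hz, besselI_mul_I hz,
      besselI_mul_neg_I hz, besselI_mul_neg_I hz,
      show (Real.pi / 2 * -μ * Complex.I : ℂ) = -(Real.pi / 2 * μ * Complex.I) by ring, neg_neg]
    set e := Complex.exp (Real.pi / 2 * μ * Complex.I) with he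
    set e' := Complex.exp (-(Real.pi / 2 * μ * Complex.I)) with he'
    have h1 : e * e - e' * e' = 2 * Complex.sin (Real.pi * μ) * Complex.I := by
      rw [he, he', ← Complex.exp_add, ← Complex.exp_add,
        show (Real.pi / 2 * μ * Complex.I + Real.pi / 2 * μ * Complex.I : ℂ)
          = Real.pi * μ * Complex.I by ring,
        show (-(Real.pi / 2 * μ * Complex.I) + -(Real.pi / 2 * μ * Complex.I) : ℂ)
          = (-(Real.pi * μ)) * Complex.I by ring, Complex.exp_mul_I, Complex.exp_mul_I,
        Complex.cos_neg, Complex.sin_neg]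
      ring
    field_simp
    linear_combination (Complex.I * besselJ μ z) * h1
      + 2 * besselJ μ z * Complex.sin (Real.pi * μ) * Complex.I_sq
  have hJ : Continuous fun μ => besselJ μ z := by
    simp only [besselJ_eq]
    exact (continuous_id.const_cpow (Or.inl (div_ne_zero hz0 two_ne_zero))).mul
      (continuous_besselSeries_order _)
  have hK1 := continuous_besselK_order (mul_I_mem_slitPlane hz)
  have hK2 := continuous_besselK_order (mul_neg_I_mem_slitPlane hz)
  have hR : Continuous fun μ : ℂ => Complex.I / Real.pi *
      (Complex.exp (Real.pi / 2 * μ * Complex.I) * besselK μ (z * Complex.I)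
        - Complex.exp (-(Real.pi / 2 * μ * Complex.I)) * besselK μ (z * -Complex.I)) := by
    fun_prop
  refine tendsto_nhds_unique ((hJ.tendsto ν).mono_left (nhdsWithin_le_nhds (s := {ν}ᶜ)))
    (((hR.tendsto ν).mono_left nhdsWithin_le_nhds).congr' ?_)
  filter_upwards [eventually_not_int ν] with μ hμ
  exact (hgeneric μ hμ).symm

theorem two_div_pi_mul_cpow {z : ℂ} (hz : 0 < z.re) :
    (2 / ((Real.pi : ℂ) * z)) ^ (1 / 2 : ℂ) =
      (2 / (Real.pi : ℂ)) ^ (1 / 2 : ℂ) / z ^ (1 / 2 : ℂ) := by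
  have hz0 : z ≠ 0 := by rintro rfl; simp at hz
  have harg := abs_lt.mp (Complex.abs_arg_lt_pi_div_two_iff.mpr (Or.inl hz))
  have h2 : (2 / (Real.pi : ℂ)) = ((2 / Real.pi : ℝ) : ℂ) := by push_cast; rfl
  have hpos : 0 < 2 / Real.pi := div_pos two_pos Real.pi_pos
  rw [← div_div, div_eq_mul_inv _ z, div_eq_mul_inv _ (z ^ (1 / 2 : ℂ)),
    ← Complex.inv_cpow _ _ (by linarith [Real.pi_pos] : z.arg ≠ Real.pi), h2,
    Complex.cpow_def_of_ne_zero (mul_ne_zero (by exact_mod_cast hpos.ne') (inv_ne_zero hz0)),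
    Complex.log_ofReal_mul hpos (inv_ne_zero hz0), add_mul, Complex.exp_add,
    Complex.cpow_def_of_ne_zero (by exact_mod_cast hpos.ne'),
    Complex.cpow_def_of_ne_zero (inv_ne_zero hz0), Complex.ofReal_log hpos.le]

theorem pi_div_two_cpow_mul :
    ((Real.pi : ℂ) / 2) ^ (1 / 2 : ℂ) * (2 / (Real.pi : ℂ)) ^ (1 / 2 : ℂ) = 1 := by
  have h : (Real.pi : ℂ) / 2 = ((Real.pi / 2 : ℝ) : ℂ) := by push_cast; rfl
  have h2 : (2 / (Real.pi : ℂ)) = ((2 / Real.pi : ℝ) : ℂ) := by push_cast; rfl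
  rw [h, h2, ← Complex.mul_cpow_ofReal_nonneg (by positivity) (by positivity), ← Complex.ofReal_mul,
    div_mul_div_cancel₀ two_ne_zero, div_self Real.pi_ne_zero]
  simp

/-- The connection formula with the factors of the large-argument expansions split off. -/
theorem besselJ_eq_cos_sin {z : ℂ} (hz : 0 < z.re) (ν : ℂ) :
    besselJ ν z = (2 / ((Real.pi : ℂ) * z)) ^ (1 / 2 : ℂ) *
      (Complex.cos (besselPhase z ν) *
        ((besselK ν (z * Complex.I) / macdonaldFactor (z * Complex.I)
          + besselK ν (z * -Complex.I) / macdonaldFactor (z * -Complex.I)) / 2)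
      + Complex.sin (besselPhase z ν) *
        ((besselK ν (z * Complex.I) / macdonaldFactor (z * Complex.I)
          - besselK ν (z * -Complex.I) / macdonaldFactor (z * -Complex.I)) / (2 * Complex.I))) := by
  have hz0 : z ≠ 0 := by rintro rfl; simp at hz
  have hpi : (Real.pi : ℂ) ≠ 0 := by exact_mod_cast Real.pi_ne_zero
  have hpq := pi_div_two_cpow_mul
  have hqq : (2 / (Real.pi : ℂ)) ^ (1 / 2 : ℂ) * (2 / (Real.pi : ℂ)) ^ (1 / 2 : ℂ)
      = 2 / Real.pi := by
    rw [← Complex.cpow_add _ _ (div_ne_zero two_ne_zero hpi)]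
    norm_num
  rw [two_div_pi_mul_cpow hz, besselJ_eq_besselK hz]
  unfold macdonaldFactor
  rw [cpow_mul_I hz, cpow_mul_neg_I hz]
  set K₁ := besselK ν (z * Complex.I)
  set K₂ := besselK ν (z * -Complex.I)
  have hs : z ^ (1 / 2 : ℂ) ≠ 0 := by simp [Complex.cpow_eq_zero_iff, hz0]
  set s := z ^ (1 / 2 : ℂ)
  set p := ((Real.pi : ℂ) / 2) ^ (1 / 2 : ℂ)
  set q := (2 / (Real.pi : ℂ)) ^ (1 / 2 : ℂ)
  have hp0 : p ≠ 0 := left_ne_zero_of_mul (hpq.trans_ne one_ne_zero)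
  have hp : p⁻¹ = q := by rw [inv_eq_one_div, div_eq_iff hp0, mul_comm, hpq]
  have hI2 := Complex.I_sq
  -- The exponentials in each of the two terms combine to `± i e^{± πiν/2}`.
  have h₁ : q / s * (K₁ / (p / (Complex.exp (Real.pi / 2 * (1 / 2) * Complex.I) * s) *
        Complex.exp (-(z * Complex.I)))) * Complex.exp (-besselPhase z ν * Complex.I) =
      2 / Real.pi * (Complex.I * (Complex.exp (Real.pi / 2 * ν * Complex.I) * K₁)) := by
    have he : Complex.exp (Real.pi / 2 * (1 / 2) * Complex.I) * Complex.exp (z * Complex.I) *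
        Complex.exp (-besselPhase z ν * Complex.I) =
        Complex.I * Complex.exp (Real.pi / 2 * ν * Complex.I) := by
      rw [← Complex.exp_add, ← Complex.exp_add, show Real.pi / 2 * (1 / 2) * Complex.I
        + z * Complex.I + -besselPhase z ν * Complex.I =
          Real.pi / 2 * Complex.I + Real.pi / 2 * ν * Complex.I by rw [besselPhase]; ring,
        Complex.exp_add, Complex.exp_pi_div_two_mul_I]
    rw [Complex.exp_neg (z * Complex.I), ← hqq]
    calc _ = q * p⁻¹ * (s / s) * K₁ * (Complex.exp (Real.pi / 2 * (1 / 2) * Complex.I) *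
          Complex.exp (z * Complex.I) * Complex.exp (-besselPhase z ν * Complex.I)) := by
          simp only [div_eq_mul_inv, mul_inv, inv_inv]; ring
      _ = _ := by rw [he, hp, div_self hs]; ring
  have h₂ : q / s * (K₂ / (p / (Complex.exp (-(Real.pi / 2 * (1 / 2) * Complex.I)) * s) *
        Complex.exp (-(z * -Complex.I)))) * Complex.exp (besselPhase z ν * Complex.I) =
      2 / Real.pi * (-Complex.I * (Complex.exp (-(Real.pi / 2 * ν * Complex.I)) * K₂)) := by
    have he : Complex.exp (-(Real.pi / 2 * (1 / 2) * Complex.I)) * Complex.exp (z * -Complex.I) *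
        Complex.exp (besselPhase z ν * Complex.I) =
        -Complex.I * Complex.exp (-(Real.pi / 2 * ν * Complex.I)) := by
      rw [← Complex.exp_add, ← Complex.exp_add, show -(Real.pi / 2 * (1 / 2) * Complex.I)
        + z * -Complex.I + besselPhase z ν * Complex.I =
          -Real.pi / 2 * Complex.I + -(Real.pi / 2 * ν * Complex.I) by rw [besselPhase]; ring,
        Complex.exp_add, Complex.exp_neg_pi_div_two_mul_I]
    rw [Complex.exp_neg (z * -Complex.I), ← hqq]
    calc _ = q * p⁻¹ * (s / s) * K₂ * (Complex.exp (-(Real.pi / 2 * (1 / 2) * Complex.I)) *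
          Complex.exp (z * -Complex.I) * Complex.exp (besselPhase z ν * Complex.I)) := by
          simp only [div_eq_mul_inv, mul_inv, inv_inv]; ring
      _ = _ := by rw [he, hp, div_self hs]; ring
  rw [Complex.exp_mul_I (-besselPhase z ν), Complex.cos_neg, Complex.sin_neg] at h₁
  rw [Complex.exp_mul_I (besselPhase z ν)] at h₂
  generalize K₁ / _ = Q₁ at h₁ ⊢
  generalize K₂ / _ = Q₂ at h₂ ⊢
  have hdiv : (Q₁ - Q₂) / (2 * Complex.I) = -Complex.I * (Q₁ - Q₂) / 2 := by
    field_simp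
    linear_combination (Q₁ - Q₂) * hI2
  rw [hdiv]
  linear_combination -(1 / 2 : ℂ) * h₁ - (1 / 2 : ℂ) * h₂

/-- The even coefficients, from the expansions at `iz` and `-iz`. -/
theorem sum_range_even (a : ℕ → ℂ) (z : ℂ) (L : ℕ) :
    ∑ n ∈ Finset.range (2 * L), a n / (z * Complex.I) ^ n
      + ∑ n ∈ Finset.range (2 * L), a n / (z * -Complex.I) ^ n =
    2 * ∑ n ∈ Finset.range L, (-1) ^ n * a (2 * n) / z ^ (2 * n) := by
  induction L with
  | zero => simp
  | succ L ih =>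
    rw [show 2 * (L + 1) = 2 * L + 1 + 1 by ring, Finset.sum_range_succ, Finset.sum_range_succ,
      Finset.sum_range_succ, Finset.sum_range_succ, Finset.sum_range_succ _ L, mul_add, ← ih]
    rw [mul_pow, mul_pow, mul_pow, mul_pow, pow_succ Complex.I, pow_succ (-Complex.I),
      pow_mul Complex.I, pow_mul (-Complex.I), neg_sq, Complex.I_sq]
    have hinv : ((-1 : ℂ) ^ L)⁻¹ = (-1) ^ L := by rw [← inv_pow]; norm_num
    simp only [div_eq_mul_inv, mul_inv, hinv, inv_neg]
    ring

/-- The odd coefficients, from the expansions at `iz` and `-iz`. -/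
theorem sum_range_odd (a : ℕ → ℂ) (z : ℂ) (M : ℕ) :
    ∑ n ∈ Finset.range (2 * M + 1), a n / (z * Complex.I) ^ n
      - ∑ n ∈ Finset.range (2 * M + 1), a n / (z * -Complex.I) ^ n =
    -(2 * Complex.I) * ∑ m ∈ Finset.range M, (-1) ^ m * a (2 * m + 1) / z ^ (2 * m + 1) := by
  induction M with
  | zero => simp
  | succ M ih =>
    have hinv : ((-1 : ℂ) ^ M)⁻¹ = (-1) ^ M := by rw [← inv_pow]; norm_num
    rw [show 2 * (M + 1) + 1 = 2 * M + 1 + 1 + 1 by ring, Finset.sum_range_succ,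
      Finset.sum_range_succ _ (2 * M + 1), Finset.sum_range_succ _ (2 * M + 1 + 1),
      Finset.sum_range_succ _ (2 * M + 1), Finset.sum_range_succ _ M, mul_add, ← ih]
    generalize ∑ n ∈ Finset.range (2 * M + 1), a n / (z * Complex.I) ^ n = S₁
    generalize ∑ n ∈ Finset.range (2 * M + 1), a n / (z * -Complex.I) ^ n = S₂
    have hI : Complex.I ^ (2 * M + 1) = (-1) ^ M * Complex.I := by
      rw [pow_succ, pow_mul, Complex.I_sq]
    have hI' : (-Complex.I) ^ (2 * M + 1) = (-1) ^ M * -Complex.I := by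
      rw [pow_succ, pow_mul, neg_sq, Complex.I_sq]
    have hsq : (-Complex.I) ^ (2 * M + 1 + 1) = Complex.I ^ (2 * M + 1 + 1) :=
      Even.neg_pow ⟨M + 1, by ring⟩ _
    rw [mul_pow, mul_pow, mul_pow, mul_pow, hsq, hI, hI']
    simp only [div_eq_mul_inv, mul_inv, hinv, inv_neg, Complex.inv_I]
    ring

/-- The two kernels at `± iz` combine to `1 / (1 + (t/z)²)`. -/
theorem inv_one_add_div_mul_I_add {z : ℂ} (hz : 0 < z.re) (t : ℝ) :
    (1 + t / (z * Complex.I))⁻¹ + (1 + t / (z * -Complex.I))⁻¹ = 2 / (1 + ((t : ℂ) / z) ^ 2) := by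
  have hz0 : z ≠ 0 := by rintro rfl; simp at hz
  have h1 : 1 - (t / z) * Complex.I ≠ 0 := by
    intro h
    have h3 : z = t * Complex.I := by
      field_simp at h
      linear_combination h
    rw [h3] at hz
    simp at hz
  have h2 : 1 + (t / z) * Complex.I ≠ 0 := by
    intro h
    have h3 : z = -(t * Complex.I) := by
      field_simp at h
      linear_combination h
    rw [h3] at hz
    simp at hz
  have e1 : (t : ℂ) / (z * Complex.I) = -((t / z) * Complex.I) := by
    rw [← div_div, Complex.div_I]
  have e2 : (t : ℂ) / (z * -Complex.I) = (t / z) * Complex.I := by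
    rw [mul_neg, div_neg, e1, neg_neg]
  have h3 : 1 + ((t : ℂ) / z) ^ 2 = (1 - (t / z) * Complex.I) * (1 + (t / z) * Complex.I) := by
    linear_combination ((t : ℂ) / z) ^ 2 * Complex.I_sq
  rw [e1, e2, h3, ← sub_eq_add_neg, eq_div_iff (mul_ne_zero h1 h2)]
  generalize (t : ℂ) / z = τ at *
  field_simp
  ring

theorem integrableOn_and_stieltjesIntegral_add {N : ℕ} {ν z : ℂ}
    (hν : |ν.re| < (N : ℝ) + 1 / 2) (hz : 0 < z.re) :
    IntegrableOn (fun t : ℝ => ((t ^ ((N : ℝ) - 1 / 2) * Real.exp (-t) : ℝ) : ℂ) /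
        (1 + ((t : ℂ) / z) ^ 2) * besselK ν (t : ℂ)) (Ioi 0) ∧
    stieltjesIntegral N ν (z * Complex.I) + stieltjesIntegral N ν (z * -Complex.I) =
      2 * ∫ t in Ioi (0 : ℝ), ((t ^ ((N : ℝ) - 1 / 2) * Real.exp (-t) : ℝ) : ℂ) /
        (1 + ((t : ℂ) / z) ^ 2) * besselK ν (t : ℂ) := by
  have hi1 := integrableOn_stieltjesIntegral hν (mul_I_mem_slitPlane hz)
  have hi2 := integrableOn_stieltjesIntegral hν (mul_neg_I_mem_slitPlane hz)
  have hpt : ∀ t ∈ Ioi (0 : ℝ),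
      (besselWeight N t : ℂ) * macdonaldIntegral ν t * (1 + t / (z * Complex.I))⁻¹
        + (besselWeight N t : ℂ) * macdonaldIntegral ν t * (1 + t / (z * -Complex.I))⁻¹ =
      2 * (((t ^ ((N : ℝ) - 1 / 2) * Real.exp (-t) : ℝ) : ℂ) /
        (1 + ((t : ℂ) / z) ^ 2) * besselK ν (t : ℂ)) := by
    intro t ht
    rw [← mul_add, inv_one_add_div_mul_I_add hz t, besselK_ofReal ν (mem_Ioi.mp ht),
      besselWeight]
    ring
  constructor
  · have h := ((hi1.add hi2).congr_fun hpt measurableSet_Ioi).const_mul (1 / 2)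
    refine h.congr (ae_of_all _ fun t => ?_)
    simp only
    rw [← mul_assoc, one_div_mul_cancel two_ne_zero, one_mul]
  · rw [stieltjesIntegral, stieltjesIntegral, ← integral_add hi1 hi2, ← integral_const_mul]
    exact setIntegral_congr_fun measurableSet_Ioi hpt

theorem remainderJ_eq {N : ℕ} {ν z : ℂ} (hν : |ν.re| < (N : ℝ) + 1 / 2) (hz : 0 < z.re) :
    remainderJ N z ν = (-1) ^ (N / 2) * remainderConst ν * (1 / z ^ N) *
      ((stieltjesIntegral N ν (z * Complex.I) + stieltjesIntegral N ν (z * -Complex.I)) / 2) := by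
  unfold remainderJ
  rw [remainderK_eq hν (mul_I_mem_slitPlane hz), remainderK_eq hν (mul_neg_I_mem_slitPlane hz)]
  have hinv : ∀ L : ℕ, ((-1 : ℂ) ^ L)⁻¹ = (-1) ^ L := fun L => by rw [← inv_pow]; norm_num
  rcases Nat.even_or_odd' N with ⟨L, rfl | rfl⟩
  · rw [if_pos (even_two_mul L), Nat.mul_div_cancel_left L two_pos, mul_pow, mul_pow,
      pow_mul Complex.I, pow_mul (-Complex.I), neg_sq, Complex.I_sq, pow_mul (-1 : ℂ)]
    simp only [div_eq_mul_inv, mul_inv, hinv]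
    norm_num
    ring
  · rw [if_neg (by simp), show (2 * L + 1) / 2 = L by omega, mul_pow, mul_pow,
      pow_succ Complex.I, pow_succ (-Complex.I), pow_mul Complex.I, pow_mul (-Complex.I), neg_sq,
      Complex.I_sq, pow_succ (-1 : ℂ) (2 * L), pow_mul (-1 : ℂ)]
    simp only [div_eq_mul_inv, mul_inv, hinv, inv_neg, Complex.inv_I]
    norm_num
    ring_nf
    simp only [Complex.I_sq]
    ring

theorem theorem8 (N : ℕ) (ν z : ℂ) (hν : |ν.re| < (N : ℝ) + 1 / 2)
    (hz0 : z ≠ 0) (hz : |Complex.arg z| < Real.pi / 2) :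
    (∀ L M : ℕ,
      besselJ ν z =
        (2 / ((Real.pi : ℂ) * z)) ^ (1 / 2 : ℂ) *
          (Complex.cos (besselPhase z ν) *
              (∑ n ∈ Finset.range L, (-1) ^ n * hankelCoeff (2 * n) ν / z ^ (2 * n) +
                remainderJ (2 * L) z ν) -
            Complex.sin (besselPhase z ν) *
              (∑ m ∈ Finset.range M, (-1) ^ m * hankelCoeff (2 * m + 1) ν / z ^ (2 * m + 1) -
                remainderJ (2 * M + 1) z ν))) ∧
    MeasureTheory.IntegrableOn
      (fun t : ℝ => ((t ^ ((N : ℝ) - 1 / 2) * Real.exp (-t) : ℝ) : ℂ) /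
        (1 + ((t : ℂ) / z) ^ 2) * besselK ν (t : ℂ)) (Set.Ioi 0) ∧
    remainderJ N z ν =
      (-1) ^ (N / 2) * (2 / (Real.pi : ℂ)) ^ (1 / 2 : ℂ) *
        (Complex.cos (Real.pi * ν) / (Real.pi : ℂ)) * (1 / z ^ N) *
        ∫ t in Set.Ioi (0 : ℝ),
          ((t ^ ((N : ℝ) - 1 / 2) * Real.exp (-t) : ℝ) : ℂ) /
            (1 + ((t : ℂ) / z) ^ 2) * besselK ν (t : ℂ) := by
  have hre : 0 < z.re := (Complex.abs_arg_lt_pi_div_two_iff.mp hz).resolve_right hz0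
  obtain ⟨hint, hsum⟩ := integrableOn_and_stieltjesIntegral_add hν hre
  refine ⟨fun L M => ?_, hint, ?_⟩
  · have hI := Complex.I_ne_zero
    have h1 := sum_range_even (fun n => hankelCoeff n ν) z L
    have h2 := sum_range_odd (fun n => hankelCoeff n ν) z M
    rw [besselJ_eq_cos_sin hre]
    congr 1
    have e1 : remainderJ (2 * L) z ν =
        (besselK ν (z * Complex.I) / macdonaldFactor (z * Complex.I)
          + besselK ν (z * -Complex.I) / macdonaldFactor (z * -Complex.I)) / 2
        - ∑ n ∈ Finset.range L, (-1) ^ n * hankelCoeff (2 * n) ν / z ^ (2 * n) := by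
      rw [remainderJ, if_pos (even_two_mul L), remainderK, remainderK]
      unfold macdonaldFactor
      linear_combination -(1 / 2 : ℂ) * h1
    have e2 : remainderJ (2 * M + 1) z ν =
        (besselK ν (z * Complex.I) / macdonaldFactor (z * Complex.I)
          - besselK ν (z * -Complex.I) / macdonaldFactor (z * -Complex.I)) / (2 * Complex.I)
        + ∑ m ∈ Finset.range M, (-1) ^ m * hankelCoeff (2 * m + 1) ν / z ^ (2 * m + 1) := by
      rw [remainderJ, if_neg (by simp), remainderK, remainderK]
      unfold macdonaldFactor
      rw [div_add' _ _ _ (mul_ne_zero two_ne_zero hI)]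
      congr 1
      linear_combination -h2
    rw [e1, e2]
    ring
  · rw [remainderJ_eq hν hre, hsum, remainderConst]
    ring
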